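/- Let $p$ be a prime, $n$ a natural number not divisible by $p$, $K$ a field of characteristic $p$, and $h\in\mathbb F_p\subset K$, $h\ne 0$. For $a\in\mathbb F_p$, $a\neq 0$, let $\tilde a\in\{1,\dots,p-1\}$ be its integer representative, and put $d=[n\tilde h/p]$, $d'=[n\,\widetilde{(-h)}/p]=[n(p-\tilde h)/p]$. Let $S$ be the complement of the diagonals $z_i=z_j$ ($i\ne j$) in affine space $\mathbb A^n_K$, and let $\mathcal V$ be the trivial bundle on $S$ whose sections are the vectors $(v_1,\dots,v_n)$ of functions with $\sum_j v_j=0$. For $i\neq j$ let $\Omega_{ij}$ be the $n\times n$ matrix with entries $-1$ at $(i,i)$ and $(j,j)$, entries $1$ at $(i,j)$ and $(j,i)$, and $0$ elsewhere. For $c\in K$ the KZ connection $\nabla^{\mathrm{KZ},c}$ on $\mathcal V$ is $\nabla_i=\partial_{z_i}+c\sum_{j\ne i}\Omega_{ij}/(z_i-z_j)$, $i=1,\dots,n$, and $\mathrm{KZ}(c)$ is the system $\nabla_i v=0$ for all $i$. Let $(x,y)=\sum_j x_jy_j$ be the Shapovalov form on $\mathcal V$. Write $P(x,z)=\prod_{s=1}^n(x-z_s)$.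 For $a\in\mathbb F_p$, $a\ne0$, let $Q^{(i)}(z,a)$ be the vector whose $j$-th coordinate is the coefficient of $x^i$ in the polynomial $P(x,z)^{\tilde a}/(x-z_j)$. The $p$-hypergeometric solutions of $\mathrm{KZ}(a)$ are the vectors $Q^{(\ell p-1)}(z,a)$, $\ell=1,\dots,[n\tilde a/p]$. Then: (1) The $p$-hypergeometric solutions of $\mathrm{KZ}(h)$ are sections of $\mathcal V$ and form a flat basis of a $\nabla^{\mathrm{KZ},h}$-invariant submodule $\mathcal U\subset\mathcal V$. So $\mathcal U$ is a trivial flat bundle of rank $d$. The quotient $\mathcal V/\mathcal U$ is a trivial flat bundle of rank $n-1-d$ (so that $\mathcal U$ is a subbundle). (2) The $p$-hypergeometric solutions of $\mathrm{KZ}(-h)$ are sections of $\mathcal V$ that are flat for $\nabla^{\mathrm{KZ},-h}$. Regarded through the Shapovalov form as functionals $v\mapsto (v,Q^{(mp-1)}(z,-h))$, $m=1,\dots,d'$, they are flat sections of $(\mathcal V,\nabla^{\mathrm{KZ},h})^*$, they annihilate $\mathcal U$, and they induce a flat basis of $(\mathcal V/\mathcal U)^*$. In particular, the Shapovalov form induces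 an isomorphism from the span $\mathcal U_{-h}$ of the $p$-hypergeometric solutions of $\mathrm{KZ}(-h)$ onto $(\mathcal V/\mathcal U)^*$. (3) If $\mathcal U\ne0$, then every $\nabla^{\mathrm{KZ},h}$-flat section of $\mathcal V$, over $S$ or over any principal open subset of $S$, belongs to $\mathcal U$. The global flat sections then form a free module over $K[z_i^p,(z_i^p-z_j^p)^{-1} : i\ne j]$ with the $p$-hypergeometric solutions of $\mathrm{KZ}(h)$ as a basis. If $\mathcal U=0$, the global flat sections form a free module of rank $n-1$ over this algebra. -/

import Mathlib

noncomputable section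

namespace KZModP

/-! ### Connections on modules -/

section Connections

variable {ι K A : Type*} [CommRing K] [CommRing A] [Algebra K A]

/-- A connection on the `A`-module `M` along the derivations `d i` of `A`: a family of additive
operators `∇ i` satisfying the Leibniz rule. -/
structure Connection (d : ι → Derivation K A A) (M : Type*) [AddCommGroup M] [Module A M] where
  /-- the covariant derivative along `d i` -/
  nabla : ι → M →+ M
  leibniz : ∀ (i : ι) (a : A) (m : M), nabla i (a • m) = d i a • m + a • nabla i m

namespace Connection

variable {d : ι → Derivation K A A} {M : Type*} [AddCommGroup M] [Module A M]

/-- A flat (horizontal) section: one that is annihilated by all covariant derivatives. -/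
def IsFlatSection (D : Connection d M) (m : M) : Prop := ∀ i, D.nabla i m = 0

/-- The bundle with connection `(M, ∇)` is a trivial flat bundle of rank `r`: it has a basis
of `r` flat sections, that is, it is isomorphic to the direct sum of `r` copies of `(A, d)`. -/
def IsTrivialFlat (D : Connection d M) (r : ℕ) : Prop :=
  ∃ b : Module.Basis (Fin r) A M, ∀ k, D.IsFlatSection (b k)

/-- A submodule that is preserved by the connection. -/
def Preserves (D : Connection d M) (U : Submodule A M) : Prop :=
  ∀ i, ∀ u ∈ U, D.nabla i u ∈ U

/-- The restriction of a connection to a submodule that it preserves. -/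
def restrict (D : Connection d M) (U : Submodule A M) (hU : D.Preserves U) :
    Connection d U where
  nabla i :=
    { toFun := fun u => ⟨D.nabla i u, hU i u u.2⟩
      map_zero' := by ext; simp
      map_add' := fun u v => by ext; simp }
  leibniz i a u := by
    ext
    exact D.leibniz i a (u : M)

/-- The connection induced on the quotient by a submodule that is preserved. -/
def quotient (D : Connection d M) (U : Submodule A M) (hU : D.Preserves U) :
    Connection d (M ⧸ U) where
  nabla i := QuotientAddGroup.map U.toAddSubgroup U.toAddSubgroup (D.nabla i)
    (fun u hu => hU i u hu)
  leibniz i a m := by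
    obtain ⟨m, rfl⟩ := U.mkQ_surjective m
    exact congrArg U.mkQ (D.leibniz i a m)

theorem quotient_mkQ (D : Connection d M) (U : Submodule A M) (hU : D.Preserves U)
    (i : ι) (m : M) : (D.quotient U hU).nabla i (U.mkQ m) = U.mkQ (D.nabla i m) := rfl

/-- The dual connection, `⟨∇* φ, m⟩ = d ⟨φ, m⟩ - ⟨φ, ∇ m⟩`. -/
def dual (D : Connection d M) : Connection d (Module.Dual A M) where
  nabla i :=
    { toFun := fun φ =>
        { toFun := fun m => d i (φ m) - φ (D.nabla i m)
          map_add' := fun m m' => by simp only [map_add]; ring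
          map_smul' := fun a m => by
            simp only [map_smul, D.leibniz, map_add, smul_eq_mul, Derivation.leibniz,
              RingHom.id_apply]
            ring }
      map_zero' := by ext; simp
      map_add' := fun φ ψ => by
        ext m
        simp only [LinearMap.add_apply, map_add, LinearMap.coe_mk, AddHom.coe_mk]
        ring }
  leibniz i a φ := by
    ext m
    simp only [AddMonoidHom.coe_mk, ZeroHom.coe_mk, LinearMap.add_apply, LinearMap.smul_apply,
      LinearMap.coe_mk, AddHom.coe_mk, smul_eq_mul, Derivation.leibniz]
    ring

/-- The flat sections, as a module over a ring `B` of functions with zero derivatives. -/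
def flatSections (D : Connection d M) (B : Subalgebra K A) (hB : ∀ i, ∀ b ∈ B, d i b = 0) :
    Submodule B M where
  carrier := {m | D.IsFlatSection m}
  zero_mem' := fun i => map_zero _
  add_mem' := fun {m m'} hm hm' i => by rw [map_add, hm i, hm' i, add_zero]
  smul_mem' := fun b m hm i => by
    change D.nabla i ((b : A) • m) = 0
    rw [D.leibniz, hB i b b.2, hm i, zero_smul, smul_zero, add_zero]

end Connection

end Connections

/-! ### The base `S` and its coordinate vector fields -/

section Base

open MvPolynomial

variable {n : ℕ} {K : Type*} [Field K]

/-- The multiplicative set generated by the equations `z i - z j`, `i ≠ j`, of the diagonals.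
The localization `Fun (diag n K)` at it is the ring of functions on the complement `S` of the diagonals in
affine space. -/
def diag (n : ℕ) (K : Type*) [Field K] : Submonoid (MvPolynomial (Fin n) K) :=
  Submonoid.closure {f | ∃ i j : Fin n, i ≠ j ∧ f = X i - X j}

variable (M : Submonoid (MvPolynomial (Fin n) K))

/-- The ring of rational functions on affine space with denominators in `M`. -/
def Fun (M : Submonoid (MvPolynomial (Fin n) K)) : Type _ := Localization M

instance : CommRing (Fun M) := inferInstanceAs (CommRing (Localization M))

instance : Algebra (MvPolynomial (Fin n) K) (Fun M) :=
  inferInstanceAs (Algebra (MvPolynomial (Fin n) K) (Localization M))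

instance : IsLocalization M (Fun M) :=
  inferInstanceAs (IsLocalization M (Localization M))

instance : Algebra K (Fun M) :=
  ((algebraMap (MvPolynomial (Fin n) K) (Fun M)).comp C).toAlgebra

instance : IsScalarTower K (MvPolynomial (Fin n) K) (Fun M) :=
  IsScalarTower.of_algebraMap_eq fun _ => rfl

/-- The coordinate function `z i`. -/
def z (i : Fin n) : Fun M := algebraMap (MvPolynomial (Fin n) K) (Fun M) (X i)

/-- The ring homomorphism `f ↦ f + ε ∂f/∂z_i` to the dual numbers. -/
def toDual (i : Fin n) :
    MvPolynomial (Fin n) K →+* TrivSqZeroExt (Fun M) (Fun M) where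
  toFun f := TrivSqZeroExt.inl (algebraMap _ (Fun M) f) +
    TrivSqZeroExt.inr (algebraMap _ (Fun M) (pderiv i f))
  map_one' := by ext <;> simp
  map_zero' := by ext <;> simp
  map_add' f g := by
    simp only [map_add, TrivSqZeroExt.inl_add, TrivSqZeroExt.inr_add]
    abel
  map_mul' f g := by
    ext
    · simp
    · simp only [Derivation.leibniz, smul_eq_mul, map_add, map_mul, TrivSqZeroExt.snd_add,
        TrivSqZeroExt.snd_inl, TrivSqZeroExt.snd_inr, TrivSqZeroExt.snd_mul,
        TrivSqZeroExt.fst_add, TrivSqZeroExt.fst_inl, TrivSqZeroExt.fst_inr, op_smul_eq_smul]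
      ring

theorem isUnit_toDual (i : Fin n) (f : M) : IsUnit (toDual M i f) := by
  rw [TrivSqZeroExt.isUnit_iff_isUnit_fst]
  simpa [toDual] using IsLocalization.map_units (Fun M) f

/-- The extension of `f ↦ f + ε ∂f/∂z_i` to rational functions. -/
def toDualLoc (i : Fin n) :
    Fun M →+* TrivSqZeroExt (Fun M) (Fun M) :=
  IsLocalization.lift (isUnit_toDual M i)

theorem toDualLoc_algebraMap (i : Fin n) (f : MvPolynomial (Fin n) K) :
    toDualLoc M i (algebraMap _ _ f) = toDual M i f :=
  IsLocalization.lift_eq _ _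

theorem fst_toDualLoc (i : Fin n) (a : Fun M) : (toDualLoc M i a).fst = a := by
  have : ((TrivSqZeroExt.fstHom (Fun M) (Fun M) (Fun M)).toRingHom.comp
      (toDualLoc M i)) = RingHom.id _ := by
    apply IsLocalization.ringHom_ext M
    ext f <;> simp [toDualLoc_algebraMap, toDual]
  exact congrArg (fun g => g a) this

/-- The partial derivative `∂/∂z_i` on the localization. -/
def partialD (i : Fin n) : Derivation K (Fun M) (Fun M) :=
  Derivation.mk'
    { toFun := fun a => (toDualLoc M i a).snd
      map_add' := fun a b => by simp
      map_smul' := fun c a => by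
        have h1 : c • a = algebraMap (MvPolynomial (Fin n) K) (Fun M) (C c) * a := by
          rw [Algebra.smul_def, IsScalarTower.algebraMap_apply K (MvPolynomial (Fin n) K)]
          rfl
        have h2 : c • (toDualLoc M i a).snd =
            algebraMap (MvPolynomial (Fin n) K) (Fun M) (C c) *
              (toDualLoc M i a).snd := by
          rw [Algebra.smul_def, IsScalarTower.algebraMap_apply K (MvPolynomial (Fin n) K)]
          rfl
        rw [RingHom.id_apply, h1, h2, map_mul, toDualLoc_algebraMap]
        simp [toDual] }
    (fun a b => by
      simp only [LinearMap.coe_mk, AddHom.coe_mk, map_mul, TrivSqZeroExt.snd_mul, fst_toDualLoc,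
        smul_eq_mul, op_smul_eq_smul])

/-- The derivation extends the usual partial derivative of polynomials. -/
theorem partialD_algebraMap (i : Fin n) (f : MvPolynomial (Fin n) K) :
    partialD M i (algebraMap _ _ f) = algebraMap _ _ (pderiv i f) := by
  change (toDualLoc M i (algebraMap _ _ f)).snd = _
  rw [toDualLoc_algebraMap]
  exact (TrivSqZeroExt.snd_add _ _).trans (by rw [TrivSqZeroExt.snd_inl, TrivSqZeroExt.snd_inr,
    zero_add])

/-- On `S`, the functions `z i - z j` with `i ≠ j` are invertible, so that the
`Ring.inverse`s below are genuine inverses there (and on each open subset of `S`). -/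
theorem isUnit_z_sub_z {M : Submonoid (MvPolynomial (Fin n) K)} (hM : diag n K ≤ M)
    {i j : Fin n} (hij : i ≠ j) : IsUnit (z M i - z M j) := by
  have := IsLocalization.map_units (Fun M)
    (⟨X i - X j, hM (Submonoid.subset_closure ⟨i, j, hij, rfl⟩)⟩ : M)
  simpa [z] using this

/-- The algebra `K[z_i ^ p, (z_i ^ p - z_j ^ p)⁻¹]`, where `i ≠ j`. -/
def powRing (p : ℕ) : Subalgebra K (Fun M) :=
  Algebra.adjoin K ({a | ∃ i, a = z M i ^ p} ∪
    {a | ∃ i j, i ≠ j ∧ a = Ring.inverse (z M i ^ p - z M j ^ p)})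

theorem partialD_pow_char (p : ℕ) [CharP K p] (i : Fin n) (a : Fun M) :
    partialD M i (a ^ p) = 0 := by
  have hp : (p : Fun M) = 0 := by
    rw [← map_natCast (algebraMap K (Fun M)), CharP.cast_eq_zero, map_zero]
  rw [Derivation.leibniz_pow, nsmul_eq_mul, hp, zero_mul]

/-- The elements of `K[z_i ^ p, (z_i ^ p - z_j ^ p)⁻¹]` have zero derivatives. -/
theorem partialD_powRing (p : ℕ) [CharP K p] (i : Fin n) :
    ∀ b ∈ powRing M p, partialD M i b = 0 := by
  intro b hb
  induction hb using Algebra.adjoin_induction with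
  | mem x hx =>
    rcases hx with ⟨j, rfl⟩ | ⟨j, k, -, rfl⟩
    · exact partialD_pow_char M p i _
    · by_cases hu : IsUnit (z M j ^ p - z M k ^ p)
      · rw [Derivation.leibniz_of_mul_eq_one (partialD M i) (Ring.inverse_mul_cancel _ hu)]
        rw [map_sub, partialD_pow_char, partialD_pow_char, sub_zero, smul_zero]
      · rw [Ring.inverse_non_unit _ hu, map_zero]
  | algebraMap r => exact (partialD M i).map_algebraMap r
  | add x y _ _ hx hy => rw [map_add, hx, hy, add_zero]
  | mul x y _ _ hx hy => rw [Derivation.leibniz, hx, hy, smul_zero, smul_zero, add_zero]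

end Base

/-! ### The KZ connection -/

section KZ

open MvPolynomial

variable {n : ℕ} {K : Type*} [Field K] (M : Submonoid (MvPolynomial (Fin n) K))

/-- The matrix `Ω_{ij}`: entries `-1` at `(i, i)` and `(j, j)`, and `1` at `(i, j)` and
`(j, i)`. -/
def Omega {A : Type*} [CommRing A] (i j : Fin n) : Matrix (Fin n) (Fin n) A :=
  Matrix.single i j 1 + Matrix.single j i 1 - Matrix.single i i 1 - Matrix.single j j 1

/-- The Gaudin Hamiltonian `H_i(z) = ∑_{j ≠ i} Ω_{ij} / (z_i - z_j)`. -/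
def gaudin (i : Fin n) : Matrix (Fin n) (Fin n) (Fun M) :=
  ∑ j ∈ Finset.univ.erase i, Ring.inverse (z M i - z M j) • Omega i j

/-- The sections of the trivial bundle whose fiber is the space of `n`-vectors with zero sum of
coordinates. -/
def sections : Submodule (Fun M) (Fin n → Fun M) :=
  LinearMap.ker (∑ j, LinearMap.proj j : (Fin n → Fun M) →ₗ[Fun M] _)

theorem mem_sections {v : Fin n → Fun M} : v ∈ sections M ↔ ∑ j, v j = 0 := by
  simp [sections]

theorem sum_Omega_mulVec {A : Type*} [CommRing A] (i j : Fin n) (v : Fin n → A) :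
    ∑ k, (Omega i j).mulVec v k = 0 := by
  have : ∀ a b : Fin n, ∑ k, (Matrix.single a b (1 : A)).mulVec v k = v b := by
    intro a b
    simp [Matrix.single_mulVec, Function.update_apply]
  simp only [Omega, Matrix.sub_mulVec, Matrix.add_mulVec, Pi.sub_apply, Pi.add_apply,
    Finset.sum_sub_distrib, Finset.sum_add_distrib, this]
  ring

theorem sum_gaudin_mulVec (i : Fin n) (v : Fin n → Fun M) :
    ∑ k, (gaudin M i).mulVec v k = 0 := by
  simp only [gaudin, Matrix.sum_mulVec, Finset.sum_apply, Matrix.smul_mulVec, Pi.smul_apply]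
  rw [Finset.sum_comm]
  refine Finset.sum_eq_zero fun j _ => ?_
  rw [← Finset.smul_sum, sum_Omega_mulVec, smul_zero]

/-- The KZ connection `∇_i = ∂/∂z_i + h H_i(z)` on vectors with zero sum of coordinates. -/
def KZ (h : K) : Connection (partialD M) (sections M) where
  nabla i :=
    { toFun := fun v =>
        ⟨(fun k => partialD M i (v.1 k)) + h • (gaudin M i).mulVec v.1, by
          rw [mem_sections]
          have hv := (mem_sections M).1 v.2
          simp only [Pi.add_apply, Pi.smul_apply, Finset.sum_add_distrib]
          rw [← map_sum, hv, map_zero, ← Finset.smul_sum, sum_gaudin_mulVec, smul_zero,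
            add_zero]⟩
      map_zero' := by ext; simp
      map_add' := fun v w => by
        ext k
        simp [Matrix.mulVec_add]
        ring }
  leibniz i a v := by
    ext k
    simp only [AddMonoidHom.coe_mk, ZeroHom.coe_mk, Submodule.coe_smul, Submodule.coe_add,
      Pi.add_apply, Pi.smul_apply, smul_eq_mul, Derivation.leibniz, Matrix.mulVec_smul]
    rw [mul_add, mul_smul_comm]
    ring

/-- The Shapovalov form `(x, y) = ∑ j, x j * y j`, as the map `y ↦ (·, y)` from sections to
linear functionals. -/
def shapovalov : sections M →ₗ[Fun M] Module.Dual (Fun M) (sections M) :=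
  LinearMap.mk₂ (Fun M) (fun y x => ∑ j, x.1 j * y.1 j)
    (fun y y' x => by simp [mul_add, Finset.sum_add_distrib])
    (fun c y x => by simp [Finset.mul_sum, mul_left_comm])
    (fun y x x' => by simp [add_mul, Finset.sum_add_distrib])
    (fun c y x => by simp [Finset.mul_sum, mul_assoc])

end KZ

/-! ### The `p`-hypergeometric solutions -/

section Hypergeometric

variable {n : ℕ} {K : Type*} [Field K]

/-- The polynomial `P(x, z) = ∏ s, (x - z_s)` in `K[z][x]`. -/
def masterP (n : ℕ) (K : Type*) [Field K] : Polynomial (MvPolynomial (Fin n) K) :=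
  ∏ s, (Polynomial.X - Polynomial.C (MvPolynomial.X s))

/-- The polynomial `P(x, z) ^ m / (x - z_j)` for `m ≥ 1`; its coefficient at `x ^ i` is the
`j`-th coordinate of the vector `Q^{(i)}`. -/
def Q (n : ℕ) (K : Type*) [Field K] (m : ℕ) (j : Fin n) : Polynomial (MvPolynomial (Fin n) K) :=
  masterP n K ^ m /ₘ (Polynomial.X - Polynomial.C (MvPolynomial.X j))

/-- The division in the definition of `Q` is exact. -/
theorem mul_Q {m : ℕ} (hm : m ≠ 0) (j : Fin n) :
    (Polynomial.X - Polynomial.C (MvPolynomial.X j)) * Q n K m j = masterP n K ^ m := by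
  rw [Q, Polynomial.mul_divByMonic_eq_iff_isRoot, Polynomial.IsRoot.def, Polynomial.eval_pow,
    masterP, Polynomial.eval_prod, Finset.prod_eq_zero (Finset.mem_univ j) (by simp),
    zero_pow hm]

/-- The `p`-hypergeometric solution `Q^{(ℓ p - 1)}`, where `ℓ = k + 1` and `m` is the
integer `1 ≤ m ≤ p - 1` that represents the parameter of the KZ equations modulo `p`. -/
def hypergeom (M : Submonoid (MvPolynomial (Fin n) K)) (p m k : ℕ) : Fin n → Fun M :=
  fun j => algebraMap _ (Fun M) ((Q n K m j).coeff ((k + 1) * p - 1))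

end Hypergeometric

end KZModP

end

noncomputable section

namespace KZModP

/-! ### Polynomials with prescribed logarithmic derivative in characteristic `p` -/

section FiberIndependence

open Polynomial

variable {F : Type*} [Field F] {p : ℕ} [Fact p.Prime] [CharP F p] {n : ℕ}

/-! Put m = h̃ and Q_j = P^m/(x - z_j). The identity (z_i - z_j) ∂_i Q_j = -m (Q_i - Q_j) shows that
∇_i sends the vector of x^N-coefficients to a vector supported in the i-th coordinate, with a factor
N + 1 (`nablaVec_coeff_Q`). For N = ℓp - 1 this factor vanishes, whence flatness.

Parts (1) and (2) say that the solutions for h and those for -h are each other's annihilators in the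
bundle. Three facts give this. The two families are orthogonal (`sum_coeff_mul_coeff_eq_zero`):
apply ∂_x + ∂_y to P(x)^h̃ P(y)^(p-h̃), whose restriction to the diagonal is P^p. Each family is
linearly independent at every closed point of S (`coeff_vectors_linearIndependent`). The ranks
satisfy d + d' + 1 = n, where the extra 1 counts the functional "sum of coordinates", independent of
the others because p does not divide n. By Nakayama, a complex with these properties is split exact
(`exact_of_forall_maximal`). The Shapovalov form pairs ∇ for c and -c flatly, so flatness passes to
the quotient and its dual.

For part (3), let v be flat for h, and form Y(x) = ∑ v_j P^(p-h̃)/(x - z_j). Its Taylor coefficients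
at x = z_i satisfy a recursion in ∂_i. The recursion expresses the coefficient y of order p - 1,
which is killed by ∂_i, through an iterated derivative of v_i. Since ∂_i^p = 0, y times a certain
derivative of a power of ∏_{s≠i} (z_i - z_s) is zero, and that derivative is nonzero exactly in the
range where 𝒰 ≠ 0 (`iterate_pderiv_prod_ne_zero`). So y = 0 (`coeff_taylor_pairingPoly_char`). By
Lucas, y is the value at z_i^p of a polynomial of degree < n whose coefficients are the pairings of
v with the solutions for -h. Having the n distinct roots z_i^p, it vanishes, and exactness puts v in
𝒰. The coefficients of v in the flat basis then have zero derivatives, that is, lie in `powRing`.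

Residues are written a + 1 and b + 1 with sum p. The base is a general `Fun M`, so that principal
open subsets are covered. -/

theorem pow_dvd_of_derivative_eq_zero {f : F[X]} (hf : derivative f = 0) {r : F}
    (hr : (X - C r) ∣ f) : (X - C r) ^ p ∣ f := by
  have hp : p ≠ 0 := (Fact.out : p.Prime).ne_zero
  have h := expand_contract p hf hp
  have hT : (contract p f).eval (r ^ p) = 0 := by
    rw [← expand_eval, h]
    exact dvd_iff_isRoot.1 hr
  obtain ⟨g, hg⟩ := dvd_iff_isRoot.2 hT
  rw [← h, hg, map_mul]
  refine Dvd.dvd.mul_right (dvd_of_eq ?_) _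
  rw [sub_pow_char, map_sub, expand_X, expand_C, C_pow]

theorem pairwise_coprime_linear {ζ : Fin n → F} (hζ : Function.Injective ζ) :
    Pairwise fun i j => IsCoprime (X - C (ζ i)) (X - C (ζ j)) :=
  fun _ _ hij => isCoprime_X_sub_C_of_isUnit_sub (sub_ne_zero.2 (hζ.ne hij)).isUnit

/-- The equation says that R/P^m has zero derivative, hence so has P^(p-m) R. This polynomial
vanishes at every ζ_s, so it is divisible by the p-th power of each linear factor. -/
theorem pow_dvd_of_mul_derivative_eq {ζ : Fin n → F} (hζ : Function.Injective ζ) {m : ℕ}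
    (hmp : m < p) {R : F[X]}
    (hR : (∏ s, (X - C (ζ s))) * derivative R =
      (m : F[X]) * derivative (∏ s, (X - C (ζ s))) * R) :
    (∏ s, (X - C (ζ s))) ^ m ∣ R := by
  set P := ∏ s, (X - C (ζ s)) with hP
  have hP0 : P ≠ 0 := (monic_prod_of_monic _ _ fun s _ => monic_X_sub_C _).ne_zero
  obtain ⟨e, he⟩ : ∃ e, p = m + (e + 1) := ⟨p - m - 1, by omega⟩
  have hd : derivative (P ^ (e + 1) * R) = 0 := by
    refine (mul_eq_zero.1 ?_).resolve_left hP0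
    have : P * derivative (P ^ (e + 1) * R) =
        P ^ (e + 1) * (P * derivative R + ((e + 1 : ℕ) : F[X]) * derivative P * R) := by
      rw [derivative_mul, derivative_pow_succ]
      push_cast
      simp only [map_add, map_natCast, map_one]
      ring
    rw [this, hR]
    have hp : ((m : F[X]) + ((e + 1 : ℕ) : F[X])) = 0 := by
      rw [← Nat.cast_add, ← he, CharP.cast_eq_zero]
    calc _ = P ^ (e + 1) * (((m : F[X]) + ((e + 1 : ℕ) : F[X])) * derivative P * R) := by ring
      _ = 0 := by rw [hp]; ring
  have h1 : P ^ p ∣ P ^ (e + 1) * R := by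
    rw [hP, ← Finset.prod_pow]
    refine Finset.prod_dvd_of_coprime
      (fun i _ j _ hij => ((pairwise_coprime_linear hζ hij).pow)) fun i _ => ?_
    refine pow_dvd_of_derivative_eq_zero hd ?_
    exact ((Finset.dvd_prod_of_mem _ (Finset.mem_univ i)).trans
      (dvd_pow_self P e.succ_ne_zero)).mul_right _
  rw [he, pow_add, mul_comm (P ^ m)] at h1
  exact (mul_dvd_mul_iff_left (pow_ne_zero _ hP0)).1 h1

/-- As x^N is missing in g, the remainder of g modulo x^(N+1) has degree < N. Multiplying by x - r
keeps it a remainder, so the quotient acquires the factor x - r. -/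
theorem eval_divByMonic_X_pow {N : ℕ} {g : F[X]} {r : F} (hg : g.coeff N = 0) :
    (((X - C r) * g) /ₘ X ^ (N + 1)).eval r = 0 := by
  have hm : (X ^ (N + 1) : F[X]).Monic := monic_X_pow _
  have h := modByMonic_add_div g (X ^ (N + 1))
  have hdeg : (g %ₘ X ^ (N + 1)).degree < (N : ℕ) := by
    rw [degree_lt_iff_coeff_zero]
    intro k hk
    have hlt := degree_modByMonic_lt g hm
    rw [degree_X_pow, degree_lt_iff_coeff_zero] at hlt
    rcases hk.eq_or_lt with rfl | hk
    · have := congrArg (fun f => f.coeff N) h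
      simpa [coeff_X_pow_mul', hg] using this
    · exact hlt k hk
  have := div_modByMonic_unique (f := (X - C r) * g) ((X - C r) * (g /ₘ X ^ (N + 1)))
    ((X - C r) * (g %ₘ X ^ (N + 1))) hm ⟨by
      conv_rhs => rw [← h]
      ring, by
      rw [degree_mul, degree_X_sub_C, degree_X_pow]
      push_cast
      rw [add_comm]
      exact WithBot.add_lt_add_right (by simp) hdeg⟩
  rw [this.1]
  simp

/-- At a point with distinct coordinates, the vectors of coefficients at `x ^ (ℓ p - 1)` of
`P ^ m / (x - ζ_j)` are linearly independent. -/
theorem coeff_vectors_linearIndependent {ζ : Fin n → F} (hζ : Function.Injective ζ) {m : ℕ}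
    (hmp : m < p) {q : Fin n → F[X]}
    (hq : ∀ j, (X - C (ζ j)) * q j = (∏ s, (X - C (ζ s))) ^ m)
    {d : ℕ} (hd : d * p ≤ n * m) (c : Fin d → F)
    (hc : ∀ j, ∑ k : Fin d, c k * (q j).coeff ((k + 1) * p - 1) = 0) : c = 0 := by
  have hp : 0 < p := (Fact.out : p.Prime).pos
  rcases Nat.eq_zero_or_pos d with h0 | hdpos
  · funext k
    exact absurd k.2 (by omega)
  set P := ∏ s, (X - C (ζ s)) with hP
  have hPm : P.Monic := monic_prod_of_monic _ _ fun s _ => monic_X_sub_C _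
  have hPdeg : P.degree = n := by
    rw [hP, degree_prod]
    simp
  obtain ⟨N, hN⟩ : ∃ N, d * p = N + 1 := ⟨d * p - 1, by
    have := Nat.mul_pos hdpos hp; omega⟩
  have hNle : N + 1 ≤ n * m := hN ▸ hd
  -- The exponents are reversed so that the given relation among the vectors becomes the vanishing
  -- of the x^N-coefficient of each q_j W. Only p-th powers of x occur, so W' = 0.
  set W : F[X] := ∑ k : Fin d, C (c k) * X ^ (p * (k.rev : ℕ)) with hW
  have hWc : ∀ k : Fin d, W.coeff (p * (k.rev : ℕ)) = c k := by
    intro k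
    rw [hW, finsetSum_coeff, Finset.sum_eq_single k]
    · simp
    · intro l _ hl
      rw [coeff_C_mul_X_pow, if_neg]
      intro he
      exact hl (Fin.rev_injective (Fin.ext (Nat.eq_of_mul_eq_mul_left hp he))).symm
    · simp
  have hWd : derivative W = 0 := by
    rw [hW, derivative_sum]
    refine Finset.sum_eq_zero fun k _ => ?_
    rw [derivative_C_mul_X_pow]
    simp
  have hWdeg : W.degree < (N + 1 : ℕ) := by
    rw [hW]
    refine (degree_sum_le _ _).trans_lt ((Finset.sup_lt_iff (WithBot.bot_lt_coe _)).2 ?_)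
    intro k _
    refine (degree_C_mul_X_pow_le _ _).trans_lt ?_
    rw [Nat.cast_lt, ← hN, mul_comm d]
    exact Nat.mul_lt_mul_of_pos_left k.rev.2 hp
  suffices hW0 : W = 0 by
    funext k
    rw [← hWc k, hW0]
    simp
  have hqW : ∀ j, (q j * W).coeff N = 0 := by
    intro j
    rw [hW, Finset.mul_sum, finsetSum_coeff, ← hc j]
    refine Finset.sum_congr rfl fun k _ => ?_
    have hNk : N = ((k + 1) * p - 1) + p * (k.rev : ℕ) := by
      have h1 : d * p = (k + 1) * p + p * (k.rev : ℕ) := by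
        rw [mul_comm p, ← add_mul, Fin.val_rev]
        congr 1
        have := k.2
        omega
      have : 0 < ((k : ℕ) + 1) * p := Nat.mul_pos k.1.succ_pos hp
      omega
    rw [mul_left_comm, coeff_C_mul]
    conv_lhs => rw [hNk]
    rw [coeff_mul_X_pow]
  have hXm : (X ^ (N + 1) : F[X]).Monic := monic_X_pow _
  -- Splitting P^m W at x^(N+1) = x^(dp), whose derivative is zero, lets the equation P f' = m P' f
  -- be tested on the two pieces separately.
  set R := (P ^ m * W) /ₘ X ^ (N + 1) with hR
  set E := (P ^ m * W) %ₘ X ^ (N + 1) with hE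
  have hRE : E + X ^ (N + 1) * R = P ^ m * W := modByMonic_add_div _ _
  have hEdeg : E.degree < (N + 1 : ℕ) := by
    simpa using degree_modByMonic_lt (P ^ m * W) hXm
  have hPR : P ∣ R := by
    refine Finset.prod_dvd_of_coprime
      (fun i _ j _ hij => pairwise_coprime_linear hζ hij) fun i _ => ?_
    rw [dvd_iff_isRoot, IsRoot.def, hR, ← hq i, mul_assoc]
    exact eval_divByMonic_X_pow (hqW i)
  have hder : P * (derivative E + X ^ (N + 1) * derivative R) =
      (m : F[X]) * derivative P * (E + X ^ (N + 1) * R) := by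
    have h1 := congrArg derivative hRE
    have hX : derivative (X ^ (N + 1) : F[X]) = 0 := by
      rw [derivative_X_pow, ← hN]
      simp
    rw [derivative_add, derivative_mul, hX, derivative_mul, hWd, zero_mul, zero_add,
      mul_zero, add_zero] at h1
    rw [h1, hRE]
    rcases Nat.eq_zero_or_pos m with rfl | hm
    · simp
    · obtain ⟨e, rfl⟩ : ∃ e, m = e + 1 := ⟨m - 1, by omega⟩
      rw [derivative_pow_succ]
      push_cast
      simp only [map_add, map_natCast, map_one]
      ring
  -- The defect of the lower piece E. It is divisible by x^(N+1) P because P divides R, but its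
  -- degree is less than N + 1 + n, so both pieces solve the equation exactly.
  set L₂ := P * derivative E - (m : F[X]) * derivative P * E with hL₂
  have hL : L₂ = X ^ (N + 1) * ((m : F[X]) * derivative P * R - P * derivative R) := by
    rw [hL₂]
    linear_combination hder
  have hPX : X ^ (N + 1) * P ∣ L₂ := by
    rw [hL]
    exact mul_dvd_mul_left _ (dvd_sub (hPR.mul_left _) (dvd_mul_right _ _))
  have hL0 : L₂ = 0 := by
    refine eq_zero_of_dvd_of_degree_lt hPX ?_
    rw [degree_mul, degree_X_pow, hPdeg]
    refine (degree_sub_le _ _).trans_lt (max_lt ?_ ?_)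
    · rw [degree_mul, hPdeg, add_comm]
      exact WithBot.add_lt_add_right (by simp) ((degree_derivative_le).trans_lt hEdeg)
    · rw [mul_assoc, ← map_natCast C, C_mul']
      refine (degree_smul_le _ _).trans_lt ?_
      rw [degree_mul, add_comm]
      exact (add_le_add le_rfl ((degree_derivative_le).trans hPdeg.le)).trans_lt
        (WithBot.add_lt_add_right (by simp) hEdeg)
  have hE' : P ^ m ∣ E := pow_dvd_of_mul_derivative_eq hζ hmp (sub_eq_zero.1 hL0)
  have hR' : P ^ m ∣ R := by
    refine pow_dvd_of_mul_derivative_eq hζ hmp ?_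
    rw [hL0] at hL
    exact (sub_eq_zero.1 ((mul_eq_zero.1 hL.symm).resolve_left hXm.ne_zero)).symm
  obtain ⟨t, ht⟩ := hR'
  obtain ⟨s, hs⟩ := hE'
  have hPm0 : (P ^ m) ≠ 0 := pow_ne_zero _ hPm.ne_zero
  have hWs : W = s + X ^ (N + 1) * t := by
    refine mul_left_cancel₀ hPm0 ?_
    rw [← hRE, ht, hs]
    ring
  have hsdeg : s.degree ≤ E.degree := by
    rw [hs, mul_comm]
    exact degree_le_mul_left _ hPm0
  -- The difference is a multiple of x^(N+1) of degree at most N. Hence E = P^m W, and if W ≠ 0 this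
  -- has degree at least nm ≥ N + 1, too large for E.
  have ht0 : W - s = 0 := by
    refine eq_zero_of_dvd_of_degree_lt (p := X ^ (N + 1)) ⟨t, by rw [hWs]; ring⟩ ?_
    rw [degree_X_pow]
    exact (degree_sub_le _ _).trans_lt (max_lt hWdeg (hsdeg.trans_lt hEdeg))
  rw [sub_eq_zero] at ht0
  by_contra hW0
  rw [hs, ← ht0, degree_mul, degree_pow, hPdeg] at hEdeg
  have h0 : (0 : WithBot ℕ) ≤ W.degree := zero_le_degree_iff.2 hW0
  have h1 : ((n * m : ℕ) : WithBot ℕ) ≤ m • (n : WithBot ℕ) + W.degree := by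
    refine le_add_of_le_of_nonneg ?_ h0
    rw [nsmul_eq_mul, mul_comm n]
    push_cast
    exact le_rfl
  have h2 := h1.trans_lt hEdeg
  rw [Nat.cast_lt] at h2
  omega

end FiberIndependence

/-! ### Exact sequences of free modules that are exact at all closed points -/

section LinearAlgebra

variable {A : Type*} [CommRing A]

/-- Vectors that span modulo each maximal ideal span. -/
theorem span_eq_top_of_forall_maximal {ι κ : Type*} [Finite κ] (w : ι → κ → A)
    (h : ∀ m : Ideal A, m.IsMaximal →
      Submodule.span (A ⧸ m) (Set.range fun i j => Ideal.Quotient.mk m (w i j)) = ⊤) :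
    Submodule.span A (Set.range w) = ⊤ := by
  classical
  cases nonempty_fintype κ
  set S := Submodule.span A (Set.range w) with hS
  have hfg : (⊤ : Submodule A ((κ → A) ⧸ S)).FG := Module.Finite.fg_top
  -- Spanning modulo m means that the cokernel C satisfies C = mC. Nakayama then gives an element of
  -- 1 + m that annihilates C, so the annihilator lies in no maximal ideal.
  have key : ∀ m : Ideal A, m.IsMaximal →
      (⊤ : Submodule A ((κ → A) ⧸ S)) ≤ m • (⊤ : Submodule A ((κ → A) ⧸ S)) := by
    intro m hm x _
    obtain ⟨e, rfl⟩ := S.mkQ_surjective x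
    have hlift : ∀ y ∈ Submodule.span (A ⧸ m)
        (Set.range fun i j => Ideal.Quotient.mk m (w i j)),
        ∃ s ∈ S, ∀ j, Ideal.Quotient.mk m (s j) = y j := by
      intro y hy
      induction hy using Submodule.span_induction with
      | mem y hy =>
        obtain ⟨i, rfl⟩ := hy
        exact ⟨w i, Submodule.subset_span ⟨i, rfl⟩, fun j => rfl⟩
      | zero => exact ⟨0, S.zero_mem, fun j => by simp⟩
      | add y y' _ _ hy hy' =>
        obtain ⟨s, hs, h1⟩ := hy
        obtain ⟨s', hs', h1'⟩ := hy'
        exact ⟨s + s', S.add_mem hs hs', fun j => by simp [h1, h1']⟩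
      | smul a y _ hy =>
        obtain ⟨s, hs, h1⟩ := hy
        obtain ⟨a, rfl⟩ := Ideal.Quotient.mk_surjective a
        exact ⟨a • s, S.smul_mem a hs, fun j => by simp [h1]⟩
    obtain ⟨s, hs, h1⟩ := hlift (fun j => Ideal.Quotient.mk m (e j)) (by rw [h m hm]; trivial)
    have h2 : S.mkQ e = S.mkQ (e - s) := by
      rw [map_sub, (Submodule.Quotient.mk_eq_zero S).2 hs |> fun h => (h : S.mkQ s = 0), sub_zero]
    rw [h2, pi_eq_sum_univ' (e - s), map_sum]
    refine Submodule.sum_mem _ fun j _ => ?_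
    rw [map_smul]
    refine Submodule.smul_mem_smul ?_ trivial
    rw [← Ideal.Quotient.eq_zero_iff_mem, Pi.sub_apply, map_sub, h1, sub_self]
  have hann : (Module.annihilator A ((κ → A) ⧸ S)) = ⊤ := by
    by_contra hne
    obtain ⟨m, hm, hle⟩ := Ideal.exists_le_maximal _ hne
    obtain ⟨r, hr, hr'⟩ := Submodule.exists_sub_one_mem_and_smul_eq_zero_of_fg_of_le_smul m ⊤
      hfg (key m hm)
    have : r ∈ m := hle (Module.mem_annihilator.2 fun x => hr' x trivial)
    exact hm.ne_top ((Ideal.eq_top_iff_one _).2 (by simpa using m.sub_mem this hr))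
  rw [eq_top_iff]
  intro e _
  have h1 : (1 : A) ∈ Module.annihilator A ((κ → A) ⧸ S) := hann ▸ trivial
  have := Module.mem_annihilator.1 h1 (S.mkQ e)
  rw [one_smul] at this
  exact (Submodule.Quotient.mk_eq_zero S).1 this

open Matrix in
theorem span_columns_eq_top {F ι κ : Type*} [Field F] [Fintype ι] [Fintype κ] {w : κ → ι → F}
    (hw : LinearIndependent F w) :
    Submodule.span F (Set.range fun i k => w k i) = ⊤ := by
  classical
  have h1 : (Matrix.of w).rank = Fintype.card κ :=
    LinearIndependent.rank_matrix (M := Matrix.of w) hw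
  rw [Matrix.rank_eq_finrank_span_cols] at h1
  refine Submodule.eq_top_of_finrank_eq ?_
  rw [Module.finrank_pi]
  exact h1

variable {ι κ ν : Type*} [Fintype ι] [Fintype κ] [Fintype ν]

/-- A complex `A^ι → A^ν → A^κ` with `card ι + card κ = card ν`, whose maps have maximal rank
at each closed point, is a split short exact sequence. -/
theorem exact_of_forall_maximal {B : ι → ν → A} {D : κ → ν → A}
    (hcard : Fintype.card ι + Fintype.card κ = Fintype.card ν)
    (horth : ∀ i k, ∑ j, B i j * D k j = 0)
    (hB : ∀ m : Ideal A, ∀ _hm : m.IsMaximal, letI := Ideal.Quotient.field m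
      LinearIndependent (A ⧸ m) fun i j => Ideal.Quotient.mk m (B i j))
    (hD : ∀ m : Ideal A, ∀ _hm : m.IsMaximal, letI := Ideal.Quotient.field m
      LinearIndependent (A ⧸ m) fun i j => Ideal.Quotient.mk m (D i j)) :
    LinearIndependent A B ∧
    (∀ g : κ → A, ∃ v : ν → A, ∀ k, ∑ j, v j * D k j = g k) ∧
    ∀ v : ν → A, (∀ k, ∑ j, v j * D k j = 0) → v ∈ Submodule.span A (Set.range B) := by
  classical
  have hsurj : ∀ g : κ → A, ∃ v : ν → A, ∀ k, ∑ j, v j * D k j = g k := by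
    have hspan : Submodule.span A (Set.range fun j k => D k j) = ⊤ := by
      refine span_eq_top_of_forall_maximal _ fun m hm => ?_
      let _ := Ideal.Quotient.field m
      exact span_columns_eq_top (hD m hm)
    intro g
    obtain ⟨v, hv⟩ := (Submodule.mem_span_range_iff_exists_fun A).1
      (hspan ▸ trivial : g ∈ Submodule.span A (Set.range fun j k => D k j))
    exact ⟨v, fun k => by simpa using congrFun hv k⟩
  -- A splitting of the map given by D. The family B together with s will be a basis: pairing with D
  -- reads off the s-coordinates, because B is orthogonal to D.
  choose s hs using fun k : κ => hsurj (Pi.single k 1)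
  have hpair : ∀ (x : ι → A) (y : κ → A) (k : κ),
      ∑ j, (∑ i, x i * B i j + ∑ l, y l * s l j) * D k j = y k := by
    intro x y k
    have h1 : ∑ j, (∑ i, x i * B i j) * D k j = ∑ i, x i * ∑ j, B i j * D k j := by
      simp only [Finset.sum_mul, Finset.mul_sum, mul_assoc]
      exact Finset.sum_comm
    have h2 : ∑ j, (∑ l, y l * s l j) * D k j = ∑ l, y l * ∑ j, s l j * D k j := by
      simp only [Finset.sum_mul, Finset.mul_sum, mul_assoc]
      exact Finset.sum_comm
    simp only [add_mul, Finset.sum_add_distrib, h1, h2, horth, hs, Pi.single_apply]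
    simp
  have hspan : Submodule.span A (Set.range (Sum.elim B s)) = ⊤ := by
    refine span_eq_top_of_forall_maximal _ fun m hm => ?_
    let _ := Ideal.Quotient.field m
    set φ := Ideal.Quotient.mk m
    have hli : LinearIndependent (A ⧸ m) fun i j => φ (Sum.elim B s i j) := by
      rw [Fintype.linearIndependent_iff]
      intro g hg
      obtain ⟨x, hx⟩ : ∃ x : ι → A, ∀ i, φ (x i) = g (Sum.inl i) :=
        ⟨fun i => (Ideal.Quotient.mk_surjective (g (Sum.inl i))).choose,
          fun i => (Ideal.Quotient.mk_surjective (g (Sum.inl i))).choose_spec⟩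
      obtain ⟨y, hy⟩ : ∃ y : κ → A, ∀ i, φ (y i) = g (Sum.inr i) :=
        ⟨fun i => (Ideal.Quotient.mk_surjective (g (Sum.inr i))).choose,
          fun i => (Ideal.Quotient.mk_surjective (g (Sum.inr i))).choose_spec⟩
      have hg' : ∀ j, φ (∑ i, x i * B i j + ∑ l, y l * s l j) = 0 := by
        intro j
        have := congrFun hg j
        simpa [hx, hy] using this
      have hr : ∀ k, g (Sum.inr k) = 0 := by
        intro k
        rw [← hy k, ← hpair x y k, map_sum]
        exact Finset.sum_eq_zero fun j _ => by rw [map_mul, hg', zero_mul]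
      have hl := Fintype.linearIndependent_iff.1 (hB m hm) (fun i => g (Sum.inl i)) (by
        rw [Fintype.sum_sum_type] at hg
        simpa [hr] using hg)
      rintro (i | k)
      · exact hl i
      · exact hr k
    refine hli.span_eq_top_of_card_eq_finrank' ?_
    rw [Fintype.card_sum, hcard, Module.finrank_pi]
  have hli : LinearIndependent A (Sum.elim B s) := by
    rcases subsingleton_or_nontrivial A with hA | hA
    · exact linearIndependent_of_subsingleton
    refine linearIndependent_of_top_le_span_of_card_le_finrank hspan.ge ?_
    rw [Fintype.card_sum, hcard, Module.finrank_pi]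
  refine ⟨(linearIndependent_sum.1 hli).1, hsurj, fun v hv => ?_⟩
  obtain ⟨g, hg⟩ := (Submodule.mem_span_range_iff_exists_fun A).1
      (hspan ▸ trivial : v ∈ Submodule.span A (Set.range (Sum.elim B s)))
  have hg' : v = fun j => ∑ i, g (Sum.inl i) * B i j + ∑ l, g (Sum.inr l) * s l j := by
    rw [← hg, Fintype.sum_sum_type]
    ext j
    simp
  have hr : ∀ k, g (Sum.inr k) = 0 := by
    intro k
    rw [← hpair (fun i => g (Sum.inl i)) (fun i => g (Sum.inr i)) k, ← hv k, hg']
  refine (Submodule.mem_span_range_iff_exists_fun A).2 ⟨fun i => g (Sum.inl i), ?_⟩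
  rw [hg']
  ext j
  simp [hr]

end LinearAlgebra

/-! ### Coefficientwise derivations -/

section CoeffDerivation

open Polynomial

variable {k A : Type*} [CommRing k] [CommRing A] [Algebra k A]

/-- The derivation of `A[X]` that applies a derivation of `A` to each coefficient. -/
def coeffD (δ : Derivation k A A) : Derivation k A[X] A[X] :=
  (PolynomialModule.equivPolynomialSelf (R := A)).toLinearMap.compDer δ.mapCoeffs

@[simp]
theorem coeff_coeffD (δ : Derivation k A A) (f : A[X]) (N : ℕ) :
    (coeffD δ f).coeff N = δ (f.coeff N) := rfl

@[simp]
theorem coeffD_C (δ : Derivation k A A) (a : A) : coeffD δ (C a) = C (δ a) := by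
  ext N
  rw [coeff_coeffD, coeff_C, coeff_C]
  split_ifs <;> simp

@[simp]
theorem coeffD_X (δ : Derivation k A A) : coeffD δ (X : A[X]) = 0 := by
  ext N
  rw [coeff_coeffD, coeff_X, coeff_zero]
  split_ifs <;> simp

theorem derivative_coeffD (δ : Derivation k A A) (f : A[X]) :
    derivative (coeffD δ f) = coeffD δ (derivative f) := by
  ext N
  rw [coeff_derivative, coeff_coeffD, coeff_coeffD, coeff_derivative, Derivation.leibniz]
  simp [mul_comm]

theorem coeffD_map_of_forall (δ : Derivation k A A) {B : Type*} [CommRing B] (g : B →+* A)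
    (hg : ∀ b, δ (g b) = 0) (f : B[X]) : coeffD δ (f.map g) = 0 := by
  ext N
  simp [hg]

end CoeffDerivation

/-! ### The master polynomial -/

section Master

open Polynomial

variable {n : ℕ} {K : Type*} [Field K]

/-- The product of the linear factors of the master polynomial other than the `i`-th. -/
def masterErase (n : ℕ) (K : Type*) [Field K] (i : Fin n) :
    Polynomial (MvPolynomial (Fin n) K) :=
  ∏ s ∈ Finset.univ.erase i, (X - C (MvPolynomial.X s))

theorem mul_masterErase (i : Fin n) :
    (X - C (MvPolynomial.X i)) * masterErase n K i = masterP n K := by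
  rw [masterErase, masterP, ← Finset.mul_prod_erase Finset.univ _ (Finset.mem_univ i)]

theorem Q_eq (m : ℕ) (j : Fin n) :
    Q n K (m + 1) j = masterP n K ^ m * masterErase n K j := by
  refine mul_left_cancel₀ (X_sub_C_ne_zero (MvPolynomial.X j)) ?_
  rw [mul_Q m.succ_ne_zero, mul_left_comm, mul_masterErase, pow_succ]

/-- This is the logarithmic derivative of P^(m+1) in x. -/
theorem sum_Q (m : ℕ) :
    ((m + 1 : ℕ) : Polynomial (MvPolynomial (Fin n) K)) * ∑ j, Q n K (m + 1) j =
      derivative (masterP n K ^ (m + 1)) := by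
  have h : derivative (masterP n K) = ∑ j, masterErase n K j := by
    rw [masterP, derivative_prod_finset]
    exact Finset.sum_congr rfl fun j _ => by simp [masterErase]
  simp only [Q_eq, ← Finset.mul_sum]
  rw [derivative_pow_succ, h]
  push_cast
  simp only [map_add, map_natCast, map_one]
  ring

theorem coeffD_masterErase (i : Fin n) :
    coeffD (MvPolynomial.pderiv i) (masterErase n K i) = 0 := by
  have h : ∀ S : Finset (Fin n), i ∉ S → coeffD (MvPolynomial.pderiv i)
      (∏ s ∈ S, (X - C (MvPolynomial.X s : MvPolynomial (Fin n) K))) = 0 := by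
    intro S
    induction S using Finset.induction_on with
    | empty => simp
    | insert a S ha ih =>
      intro hi
      rw [Finset.mem_insert, not_or] at hi
      rw [Finset.prod_insert ha, Derivation.leibniz, ih hi.2, map_sub, coeffD_X, coeffD_C,
        MvPolynomial.pderiv_X_of_ne (Ne.symm hi.1)]
      simp
  exact h _ (Finset.notMem_erase _ _)

theorem coeffD_masterP_pow (m : ℕ) (i : Fin n) :
    coeffD (MvPolynomial.pderiv i) (masterP n K ^ (m + 1)) =
      -((m + 1 : ℕ) : Polynomial (MvPolynomial (Fin n) K)) * Q n K (m + 1) i := by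
  rw [Derivation.leibniz_pow, ← mul_masterErase i, Derivation.leibniz, coeffD_masterErase,
    mul_masterErase, map_sub, coeffD_X, coeffD_C, MvPolynomial.pderiv_X_self, Q_eq]
  simp only [smul_eq_mul, nsmul_eq_mul, C_1, Nat.add_sub_cancel]
  ring

theorem coeffD_Q (m : ℕ) {i j : Fin n} (hij : i ≠ j) :
    (C (MvPolynomial.X i) - C (MvPolynomial.X j)) *
      coeffD (MvPolynomial.pderiv i) (Q n K (m + 1) j) =
      -((m + 1 : ℕ) : Polynomial (MvPolynomial (Fin n) K)) *
        (Q n K (m + 1) i - Q n K (m + 1) j) := by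
  have h := congrArg (coeffD (MvPolynomial.pderiv i)) (mul_Q (K := K) m.succ_ne_zero j)
  rw [Nat.succ_eq_add_one, coeffD_masterP_pow, Derivation.leibniz, map_sub, coeffD_X, coeffD_C,
    MvPolynomial.pderiv_X_of_ne (Ne.symm hij), C_0, sub_zero, smul_zero, add_zero,
    smul_eq_mul] at h
  refine mul_left_cancel₀ (X_sub_C_ne_zero (MvPolynomial.X j)) ?_
  have hi := mul_Q (K := K) m.succ_ne_zero i
  have hj := mul_Q (K := K) m.succ_ne_zero j
  rw [Nat.succ_eq_add_one] at hi hj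
  linear_combination (C (MvPolynomial.X i) - C (MvPolynomial.X j)) * h +
    ((m + 1 : ℕ) : Polynomial (MvPolynomial (Fin n) K)) * (hi - hj)

/-- The generating function ∑ q_j(x) r_j(y) is, up to a nonzero constant, of the form (∂_x + ∂_y) G.
A derivative in x or y has no terms with exponent ≡ -1 mod p in that variable, so the coefficients
at x^((k+1)p-1) y^((l+1)p-1) vanish. -/
theorem sum_coeff_mul_coeff_eq_zero {R ι : Type*} [CommRing R] [IsDomain R] [Fintype ι] {p : ℕ}
    [Fact p.Prime] [CharP R p] {a b : ℕ} (hab : a + 1 + (b + 1) = p) {P : R[X]} {ζ : ι → R}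
    {q r : ι → R[X]} (hq : ∀ j, (X - C (ζ j)) * q j = P ^ (a + 1))
    (hr : ∀ j, (X - C (ζ j)) * r j = P ^ (b + 1))
    (hqs : ((a + 1 : ℕ) : R[X]) * ∑ j, q j = derivative (P ^ (a + 1)))
    (hrs : ((b + 1 : ℕ) : R[X]) * ∑ j, r j = derivative (P ^ (b + 1))) (k l : ℕ) :
    ∑ j, (q j).coeff ((k + 1) * p - 1) * (r j).coeff ((l + 1) * p - 1) = 0 := by
  have hp : 0 < p := (Fact.out : p.Prime).pos
  set S : R[X][X] := ∑ j, C (q j) * (r j).map C with hS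
  set F : R[X][X] := C (P ^ (a + 1)) * (P ^ (b + 1)).map C with hF
  -- D = ∂_x + ∂_y, with x the inner and y the outer variable; it annihilates y - x.
  set D : Derivation R R[X][X] R[X][X] :=
    coeffD derivative' + (derivative' (R := R[X])).restrictScalars R with hD
  have hDC : ∀ f : R[X], D (C f) = C (derivative f) := by
    intro f
    rw [hD, Derivation.add_apply, coeffD_C]
    simp [Polynomial.derivative']
  have hDmap : ∀ f : R[X], D (f.map C) = (derivative f).map C := by
    intro f
    rw [hD, Derivation.add_apply, coeffD_map_of_forall _ _ (fun b => by
      simp [Polynomial.derivative'])]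
    simp [Polynomial.derivative', derivative_map]
  have hDX : D (X - C X) = 0 := by
    rw [map_sub, hDC, derivative_X, hD, Derivation.add_apply, coeffD_X]
    simp [Polynomial.derivative']
  have hDF : D F = ((a + 1 : ℕ) : R[X][X]) * ((X - C X) * S) := by
    have hterm : ∀ j, (X - C X) * (C (q j) * (r j).map C) =
        C (q j) * (P ^ (b + 1)).map C - C (P ^ (a + 1)) * (r j).map C := by
      intro j
      rw [← hr j, ← hq j]
      simp only [Polynomial.map_mul, Polynomial.map_sub, map_X, map_C, C_mul, C_sub]
      ring
    -- The two exponents are opposite modulo p; this makes the terms of D F combine into (y - x) S.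
    have hcast : ((b + 1 : ℕ) : R[X][X]) = -((a + 1 : ℕ) : R[X][X]) := by
      rw [eq_neg_iff_add_eq_zero, add_comm, ← Nat.cast_add, hab, CharP.cast_eq_zero]
    have h1 := congrArg (C : R[X] → R[X][X]) hqs
    have h2 := congrArg (Polynomial.map (C : R →+* R[X])) hrs
    rw [C_mul, map_natCast, map_sum] at h1
    rw [Polynomial.map_mul, Polynomial.map_natCast, Polynomial.map_sum, hcast] at h2
    rw [hF, Derivation.leibniz, hDC, hDmap, hS, Finset.mul_sum]
    simp only [hterm]
    rw [Finset.sum_sub_distrib, ← Finset.sum_mul, ← Finset.mul_sum, smul_eq_mul, smul_eq_mul,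
      ← h1, ← h2]
    ring
  -- On the diagonal F equals P^p, which D kills. Hence D F = (y - x) D G, and the factor y - x
  -- cancels.
  obtain ⟨G, hG⟩ : (X - C X) ∣ F - C (P ^ p) := by
    have := X_sub_C_dvd_sub_C_eval (a := (X : R[X])) (p := F)
    rwa [hF, eval_mul, eval_C, eval_map, eval₂_C_X, ← pow_add, hab] at this
  have hDG : ((a + 1 : ℕ) : R[X][X]) * S = D G := by
    refine mul_left_cancel₀ (X_sub_C_ne_zero (X : R[X])) ?_
    have h1 := congrArg D hG
    rw [map_sub, hDC, derivative_pow, CharP.cast_eq_zero, C_0, zero_mul, zero_mul, C_0, sub_zero,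
      hDF, Derivation.leibniz, hDX, smul_zero, add_zero, smul_eq_mul] at h1
    rw [← h1]
    ring
  have h := congrArg (fun f => (f.coeff ((l + 1) * p - 1)).coeff ((k + 1) * p - 1)) hDG
  have hc : ∀ l : ℕ, (((l + 1) * p - 1 : ℕ) + 1 : ℕ) = (l + 1) * p := fun l =>
    Nat.sub_add_cancel (Nat.mul_pos l.succ_pos hp)
  have hR : (((a + 1 : ℕ) : R)) ≠ 0 := by
    rw [Ne, CharP.cast_eq_zero_iff R p]
    exact fun hd => by have := Nat.le_of_dvd a.succ_pos hd; omega
  have h0 : ((D G).coeff ((l + 1) * p - 1)).coeff ((k + 1) * p - 1) = 0 := by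
    rw [hD, Derivation.add_apply, coeff_add, coeff_coeffD, coeff_add]
    change (derivative _).coeff _ + ((derivative G).coeff _).coeff _ = 0
    rw [coeff_derivative, coeff_derivative, ← Nat.cast_succ, ← Nat.cast_succ, Nat.succ_eq_add_one,
      Nat.succ_eq_add_one, hc, hc]
    simp
  refine (mul_eq_zero.1 (?_ : ((a + 1 : ℕ) : R) * _ = 0)).resolve_left hR
  rw [← h0, ← h, ← map_natCast C, coeff_C_mul, ← map_natCast C, coeff_C_mul, hS, finsetSum_coeff,
    finsetSum_coeff]
  simp

/-- The coefficient vectors of `P ^ a / (x - z_j)` and `P ^ (p - a) / (x - z_j)` at exponents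
congruent to `-1` modulo `p` are orthogonal. -/
theorem sum_coeff_Q_mul_coeff_Q {p : ℕ} [Fact p.Prime] [CharP K p] {a b : ℕ}
    (hab : a + 1 + (b + 1) = p) (k l : ℕ) :
    ∑ j, (Q n K (a + 1) j).coeff ((k + 1) * p - 1) *
      (Q n K (b + 1) j).coeff ((l + 1) * p - 1) = 0 :=
  sum_coeff_mul_coeff_eq_zero hab (mul_Q a.succ_ne_zero) (mul_Q b.succ_ne_zero) (sum_Q a)
    (sum_Q b) k l

theorem sum_coeff_Q {p : ℕ} [Fact p.Prime] [CharP K p] {m : ℕ} (hm : m + 1 < p) (l : ℕ) :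
    ∑ j, (Q n K (m + 1) j).coeff ((l + 1) * p - 1) = 0 := by
  have hp : 0 < p := (Fact.out : p.Prime).pos
  have h := congrArg (fun f => f.coeff ((l + 1) * p - 1)) (sum_Q (n := n) (K := K) m)
  have hR : (((m + 1 : ℕ) : MvPolynomial (Fin n) K)) ≠ 0 := by
    rw [Ne, CharP.cast_eq_zero_iff _ p]
    exact fun hd => by have := Nat.le_of_dvd m.succ_pos hd; omega
  simp only [← map_natCast C, coeff_C_mul, finsetSum_coeff, coeff_derivative] at h
  rw [← Nat.cast_succ, Nat.succ_eq_add_one, Nat.sub_add_cancel (Nat.mul_pos l.succ_pos hp)] at h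
  exact (mul_eq_zero.1 (h.trans (by simp))).resolve_left hR

end Master

/-! ### The KZ operators on vectors -/

section Nabla

open MvPolynomial

variable {n : ℕ} {K : Type*} [Field K] (M : Submonoid (MvPolynomial (Fin n) K))

/-- The operator `∂/∂z_i + c H_i(z)` on all vectors. -/
def nablaVec (c : K) (i : Fin n) (v : Fin n → Fun M) : Fin n → Fun M :=
  (fun k => partialD M i (v k)) + c • (gaudin M i).mulVec v

theorem Omega_mulVec {A : Type*} [CommRing A] (i j : Fin n) (v : Fin n → A) :
    (Omega i j).mulVec v = Pi.single i (v j - v i) + Pi.single j (v i - v j) := by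
  have : ∀ a b : Fin n, (Matrix.single a b (1 : A)).mulVec v = Pi.single a (v b) := by
    intro a b
    ext k
    simp [Matrix.single_mulVec, Function.update_apply, Pi.single_apply]
  simp only [Omega, Matrix.sub_mulVec, Matrix.add_mulVec, this, Pi.single_sub]
  abel

theorem gaudin_mulVec (i : Fin n) (v : Fin n → Fun M) (k : Fin n) :
    (gaudin M i).mulVec v k = ∑ j ∈ Finset.univ.erase i, Ring.inverse (z M i - z M j) *
      ((Pi.single i (v j - v i) : Fin n → Fun M) k +
        (Pi.single j (v i - v j) : Fin n → Fun M) k) := by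
  simp only [gaudin, Matrix.sum_mulVec, Finset.sum_apply, Matrix.smul_mulVec, Pi.smul_apply,
    Omega_mulVec, Pi.add_apply, smul_eq_mul]

theorem gaudin_mulVec_of_ne {i k : Fin n} (hik : i ≠ k) (v : Fin n → Fun M) :
    (gaudin M i).mulVec v k = Ring.inverse (z M i - z M k) * (v i - v k) := by
  rw [gaudin_mulVec, Finset.sum_eq_single k]
  · rw [Pi.single_eq_of_ne hik.symm, Pi.single_eq_same, zero_add]
  · intro j _ hj
    rw [Pi.single_eq_of_ne hik.symm, Pi.single_eq_of_ne hj.symm, zero_add, mul_zero]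
  · intro h
    exact absurd (Finset.mem_erase.2 ⟨hik.symm, Finset.mem_univ k⟩) h

theorem gaudin_transpose (i : Fin n) : (gaudin M i).transpose = gaudin M i := by
  rw [gaudin, Matrix.transpose_sum]
  refine Finset.sum_congr rfl fun j _ => ?_
  rw [Matrix.transpose_smul]
  simp only [Omega, Matrix.transpose_sub, Matrix.transpose_add, Matrix.transpose_single]
  congr 3
  exact add_comm _ _

theorem sum_nablaVec (c : K) (i : Fin n) (v : Fin n → Fun M) :
    ∑ k, nablaVec M c i v k = partialD M i (∑ k, v k) := by
  simp only [nablaVec, Pi.add_apply, Pi.smul_apply, Finset.sum_add_distrib, ← map_sum]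
  rw [← Finset.smul_sum, sum_gaudin_mulVec, smul_zero, add_zero]

/-- The Shapovalov form is compatible with the KZ operators with opposite parameters. -/
theorem partialD_sum_mul (c : K) (i : Fin n) (v w : Fin n → Fun M) :
    partialD M i (∑ j, v j * w j) =
      ∑ j, nablaVec M c i v j * w j + ∑ j, v j * nablaVec M (-c) i w j := by
  have h : ∑ j, (gaudin M i).mulVec v j * w j = ∑ j, v j * (gaudin M i).mulVec w j := by
    change dotProduct _ _ = dotProduct _ _
    rw [Matrix.dotProduct_mulVec, ← Matrix.mulVec_transpose, gaudin_transpose]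
  simp only [nablaVec, Pi.add_apply, Pi.smul_apply, add_mul, mul_add, Finset.sum_add_distrib,
    smul_mul_assoc, mul_smul_comm, ← Finset.smul_sum, h]
  rw [map_sum, neg_smul]
  simp only [Derivation.leibniz, smul_eq_mul, Finset.sum_add_distrib, mul_comm (w _)]
  ring

variable {M}

theorem inverse_mul_eq_of_mul_eq (hM : diag n K ≤ M) {i j : Fin n} (hij : i ≠ j) {x y : Fun M}
    (h : (z M i - z M j) * x = y) : Ring.inverse (z M i - z M j) * y = x := by
  rw [← h, ← mul_assoc, Ring.inverse_mul_cancel _ (isUnit_z_sub_z hM hij), one_mul]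

theorem algebraMap_natCast (m : ℕ) :
    algebraMap (MvPolynomial (Fin n) K) (Fun M) (m : MvPolynomial (Fin n) K) = m :=
  map_natCast _ m

theorem smul_eq_natCast_mul (m : ℕ) (a : Fun M) : (m : K) • a = (m : Fun M) * a := by
  rw [Algebra.smul_def, map_natCast]

/-- The KZ operators on the coefficient vectors of `P ^ m / (x - z_j)`. -/
theorem nablaVec_coeff_Q (hM : diag n K ≤ M) {m : ℕ} (hm : ((m + 1 : ℕ) : K) ≠ 0) (N : ℕ)
    (i : Fin n) :
    nablaVec M ((m + 1 : ℕ) : K) i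
      (fun j => algebraMap _ (Fun M) ((Q n K (m + 1) j).coeff N)) =
      Pi.single i (algebraMap _ (Fun M)
        (-((N : MvPolynomial (Fin n) K) + 1) * (Q n K (m + 1) i).coeff (N + 1))) := by
  -- Away from the i-th coordinate only one term of the Gaudin Hamiltonian survives, and `coeffD_Q`
  -- cancels it. The i-th coordinate then equals the sum of all coordinates, on which the
  -- Hamiltonian does not act.
  have hne : ∀ k, k ≠ i → nablaVec M ((m + 1 : ℕ) : K) i
      (fun j => algebraMap _ (Fun M) ((Q n K (m + 1) j).coeff N)) k = 0 := by
    intro k hk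
    have h := congrArg (fun f => f.coeff N) (coeffD_Q (K := K) m hk.symm)
    simp only [← map_natCast (Polynomial.C : MvPolynomial (Fin n) K →+* _), ← map_neg,
      ← map_sub, Polynomial.coeff_C_mul, coeff_coeffD, Polynomial.coeff_sub] at h
    have h' := congrArg (algebraMap _ (Fun M)) h
    rw [map_mul, map_sub, map_mul, ← partialD_algebraMap, map_sub, map_neg] at h'
    have h'' := inverse_mul_eq_of_mul_eq hM hk.symm h'
    simp only [nablaVec, Pi.add_apply, Pi.smul_apply]
    rw [gaudin_mulVec_of_ne M hk.symm, ← h'', smul_eq_natCast_mul, algebraMap_natCast]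
    ring
  funext k
  by_cases hk : k = i
  · subst hk
    rw [Pi.single_eq_same]
    have hs := sum_nablaVec M ((m + 1 : ℕ) : K) k
      (fun j => algebraMap _ (Fun M) ((Q n K (m + 1) j).coeff N))
    rw [Finset.sum_eq_single k (fun b _ hb => hne b hb) (fun h => absurd (Finset.mem_univ _) h),
      ← map_sum, partialD_algebraMap] at hs
    rw [hs]
    congr 1
    have hR : ((m + 1 : ℕ) : MvPolynomial (Fin n) K) ≠ 0 := by
      rw [← map_natCast C]
      exact (map_ne_zero_iff _ (C_injective _ _)).2 hm
    refine mul_left_cancel₀ hR ?_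
    have h1 := congrArg (fun f => (coeffD (pderiv k) f).coeff N) (sum_Q (n := n) (K := K) m)
    simp only [← derivative_coeffD, coeffD_masterP_pow,
      ← map_natCast (Polynomial.C : MvPolynomial (Fin n) K →+* _), ← map_neg,
      Polynomial.derivative_C_mul, Polynomial.coeff_C_mul, coeff_coeffD, Polynomial.finsetSum_coeff,
      Polynomial.coeff_derivative] at h1
    rw [Derivation.leibniz, Derivation.map_natCast, smul_zero, add_zero, smul_eq_mul] at h1
    rw [h1]
    ring
  · rw [hne k hk, Pi.single_eq_of_ne hk]

end Nabla

/-! ### The `p`-hypergeometric solutions: flatness, orthogonality, independence -/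

section Solutions

variable {n : ℕ} {K : Type*} [Field K] {M : Submonoid (MvPolynomial (Fin n) K)} {p : ℕ}
  [CharP K p]

theorem natCast_succ_ne_zero {m : ℕ} (hm : m + 1 < p) : ((m + 1 : ℕ) : K) ≠ 0 := by
  rw [Ne, CharP.cast_eq_zero_iff K p]
  exact fun hd => by have := Nat.le_of_dvd m.succ_pos hd; omega

variable [Fact p.Prime]

theorem succ_mul_sub_one_add_one (k : ℕ) : (k + 1) * p - 1 + 1 = (k + 1) * p :=
  Nat.sub_add_cancel (Nat.mul_pos k.succ_pos (Fact.out : p.Prime).pos)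

/-- The numbers n(a+1) and n(b+1) add up to np and neither is divisible by p, so their quotients by
p add up to n - 1. -/
theorem div_add_div_add_one {a b : ℕ} (hab : a + 1 + (b + 1) = p) (hn : ¬ p ∣ n) :
    n * (a + 1) / p + (n * (b + 1) / p + 1) = n := by
  have hp : 0 < p := (Fact.out : p.Prime).pos
  have h1 : n * (b + 1) = p * n - n * (a + 1) := by
    rw [← hab]
    refine (Nat.sub_eq_of_eq_add ?_).symm
    ring
  have hnd : ¬ p ∣ n * (a + 1) := fun h =>
    ((Fact.out : p.Prime).dvd_mul.1 h).elim hn fun h2 => by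
      have := Nat.le_of_dvd a.succ_pos h2
      omega
  have hle : n * (a + 1) ≤ p * n := by
    rw [mul_comm p]
    exact Nat.mul_le_mul_left _ (by omega)
  have hmod : 0 < n * (a + 1) % p := Nat.pos_of_ne_zero fun h => hnd (Nat.dvd_of_mod_eq_zero h)
  have hlt : n * (a + 1) % p < p := Nat.mod_lt _ hp
  have hdm := Nat.div_add_mod (n * (a + 1)) p
  set q := n * (a + 1) / p
  set r := n * (a + 1) % p
  have hqn : q + 1 ≤ n := by
    by_contra hcon
    have : p * n ≤ p * q := Nat.mul_le_mul_left _ (by omega)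
    omega
  obtain ⟨t, ht⟩ := Nat.exists_eq_add_of_le hqn
  have h2 : n * (b + 1) = (p - r) + p * t := by
    rw [h1, ← hdm]
    have : p * n = p * q + p + p * t := by rw [ht]; ring
    omega
  rw [h2, Nat.add_mul_div_left _ _ hp, Nat.div_eq_of_lt (by omega)]
  omega

theorem sum_hypergeom {m : ℕ} (hm : m + 1 < p) (k : ℕ) :
    ∑ j, hypergeom M p (m + 1) k j = 0 := by
  simp only [hypergeom, ← map_sum, sum_coeff_Q hm, map_zero]

theorem sum_hypergeom_mul {a b : ℕ} (hab : a + 1 + (b + 1) = p) (k l : ℕ) :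
    ∑ j, hypergeom M p (a + 1) k j * hypergeom M p (b + 1) l j = 0 := by
  simp only [hypergeom, ← map_mul, ← map_sum, sum_coeff_Q_mul_coeff_Q hab, map_zero]

theorem nablaVec_hypergeom (hM : diag n K ≤ M) {m : ℕ} (hm : m + 1 < p) (k : ℕ) (i : Fin n) :
    nablaVec M ((m + 1 : ℕ) : K) i (hypergeom M p (m + 1) k) = 0 := by
  have h := nablaVec_coeff_Q (M := M) hM (natCast_succ_ne_zero (K := K) hm) ((k + 1) * p - 1) i
  rw [← Nat.cast_succ, Nat.succ_eq_add_one, succ_mul_sub_one_add_one] at h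
  rw [Nat.cast_mul, CharP.cast_eq_zero (MvPolynomial (Fin n) K) p, mul_zero, neg_zero, zero_mul, map_zero,
    Pi.single_zero] at h
  exact h

/-- The differences z_i - z_j are units, so the z_i stay distinct in every residue field and the
independence result over a field applies there. -/
theorem hypergeom_linearIndependent_mod (hM : diag n K ≤ M) {m d : ℕ} (hm : m + 1 < p)
    (hd : d * p ≤ n * (m + 1)) (I : Ideal (Fun M)) (_hI : I.IsMaximal) :
    letI := Ideal.Quotient.field I
    LinearIndependent (Fun M ⧸ I) fun (k : Fin d) j =>
      Ideal.Quotient.mk I (hypergeom M p (m + 1) k j) := by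
  let _ := Ideal.Quotient.field I
  have hchar : CharP (Fun M ⧸ I) p := charP_of_injective_ringHom
    ((Ideal.Quotient.mk I).comp (algebraMap K (Fun M))).injective p
  set φ : MvPolynomial (Fin n) K →+* Fun M ⧸ I := (Ideal.Quotient.mk I).comp (algebraMap _ _)
    with hφ
  rw [Fintype.linearIndependent_iff]
  intro c hc
  have hinj : Function.Injective fun j => φ (MvPolynomial.X j) := by
    intro i j hij
    by_contra hne
    have h1 := (isUnit_z_sub_z hM hne).map (Ideal.Quotient.mk I)
    rw [map_sub] at h1
    exact h1.ne_zero (sub_eq_zero.2 hij)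
  have h := coeff_vectors_linearIndependent hinj hm
    (q := fun j => (Q n K (m + 1) j).map φ) (fun j => by
      have := congrArg (Polynomial.map φ) (mul_Q (K := K) m.succ_ne_zero j)
      simpa [masterP, Polynomial.map_prod] using this) hd c (fun j => by
      have := congrFun hc j
      simpa [hypergeom, hφ] using this)
  exact fun k => congrFun h k

/-- The functionals given by the `p`-hypergeometric solutions and by the sum of coordinates. -/
def functionals (M : Submonoid (MvPolynomial (Fin n) K)) (p m e : ℕ) :
    Option (Fin e) → Fin n → Fun M
  | none => 1
  | some k => hypergeom M p m k

theorem functionals_linearIndependent_mod (hM : diag n K ≤ M) (hn : ¬ p ∣ n) {m e : ℕ}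
    (hm : m + 1 < p) (he : e * p ≤ n * (m + 1)) (I : Ideal (Fun M)) (hI : I.IsMaximal) :
    letI := Ideal.Quotient.field I
    LinearIndependent (Fun M ⧸ I) fun (k : Option (Fin e)) j =>
      Ideal.Quotient.mk I (functionals M p (m + 1) e k j) := by
  let _ := Ideal.Quotient.field I
  have hchar : CharP (Fun M ⧸ I) p := charP_of_injective_ringHom
    ((Ideal.Quotient.mk I).comp (algebraMap K (Fun M))).injective p
  have hli := Fintype.linearIndependent_iff.1
    (hypergeom_linearIndependent_mod (p := p) hM hm he I hI)
  rw [Fintype.linearIndependent_iff]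
  intro c hc
  rw [Fintype.sum_option] at hc
  -- Summing coordinates kills the solutions and sends the constant vector 1 to n, which is nonzero
  -- in characteristic p.
  have h0 : c none = 0 := by
    have h1 := congrArg (fun v => ∑ j, v j) hc
    simp only [functionals, Pi.add_apply, Finset.sum_apply, Pi.smul_apply, smul_eq_mul,
      Finset.sum_add_distrib, Pi.one_apply, map_one, mul_one, Finset.sum_const, Finset.card_univ,
      Fintype.card_fin, Pi.zero_apply, nsmul_eq_mul, mul_zero] at h1
    rw [Finset.sum_comm] at h1
    simp only [← Finset.mul_sum, ← map_sum, sum_hypergeom hm, map_zero, mul_zero,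
      Finset.sum_const_zero, add_zero] at h1
    refine (mul_eq_zero.1 h1).resolve_left ?_
    exact fun h => hn ((CharP.cast_eq_zero_iff _ p n).1 h)
  rintro (_ | k)
  · exact h0
  · refine hli (fun k => c (some k)) ?_ k
    rw [h0, zero_smul, zero_add] at hc
    exact hc

/-- The solutions of the equations with opposite parameters form dual exact sequences. -/
theorem hypergeom_exact (hM : diag n K ≤ M) (hn : ¬ p ∣ n) {a b : ℕ}
    (hab : a + 1 + (b + 1) = p) :
    LinearIndependent (Fun M)
      (fun k : Fin (n * (a + 1) / p) => hypergeom M p (a + 1) k) ∧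
    (∀ (s : Fun M) (g : Fin (n * (b + 1) / p) → Fun M), ∃ v : Fin n → Fun M, ∑ j, v j = s ∧
      ∀ k : Fin (n * (b + 1) / p), ∑ j, v j * hypergeom M p (b + 1) k j = g k) ∧
    ∀ v : Fin n → Fun M, ∑ j, v j = 0 →
      (∀ k : Fin (n * (b + 1) / p), ∑ j, v j * hypergeom M p (b + 1) k j = 0) →
      v ∈ Submodule.span (Fun M) (Set.range
        fun k : Fin (n * (a + 1) / p) => hypergeom M p (a + 1) k) := by
  obtain ⟨h1, h2, h3⟩ := exact_of_forall_maximal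
    (B := fun k : Fin (n * (a + 1) / p) => hypergeom M p (a + 1) k)
    (D := functionals M p (b + 1) (n * (b + 1) / p))
    (by simpa using div_add_div_add_one hab hn)
    (by
      rintro k (_ | l)
      · simpa [functionals] using sum_hypergeom (M := M) (by omega) (k : ℕ)
      · exact sum_hypergeom_mul hab k l)
    (hypergeom_linearIndependent_mod hM (by omega) (Nat.div_mul_le_self _ _))
    (functionals_linearIndependent_mod hM hn (by omega) (Nat.div_mul_le_self _ _))
  refine ⟨h1, fun s g => ?_, fun v hs hv => h3 v ?_⟩
  · obtain ⟨v, hv⟩ := h2 (fun k => k.elim s g)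
    exact ⟨v, by simpa [functionals] using hv none, fun k => hv (some k)⟩
  · rintro (_ | k)
    · simpa [functionals] using hs
    · exact hv k

end Solutions

/-! ### Functions with zero derivatives -/

section Constants

open MvPolynomial

variable {n : ℕ} {K : Type*} [Field K] {p : ℕ}

/-- Leibniz's rule truncated after two terms. For l + 1 = p the second term also vanishes, which
yields ∂^p = 0 by induction on monomials. -/
theorem iterate_mul_of_apply_apply_eq_zero {k A : Type*} [CommRing k] [CommRing A] [Algebra k A]
    (δ : Derivation k A A) {x : A} (hx : δ (δ x) = 0) (f : A) (l : ℕ) :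
    δ^[l + 1] (x * f) = x * δ^[l + 1] f + (l + 1 : ℕ) * δ x * δ^[l] f := by
  induction l with
  | zero =>
    simp only [zero_add, Function.iterate_one, Derivation.leibniz, smul_eq_mul,
      Function.iterate_zero, id_eq, Nat.cast_one, one_mul]
    ring
  | succ l ih =>
    rw [Function.iterate_succ_apply', ih, map_add, δ.leibniz, δ.leibniz ((l + 1 : ℕ) * δ x),
      δ.leibniz ((l + 1 : ℕ) : A), Derivation.map_natCast, hx,
      ← Function.iterate_succ_apply' δ, ← Function.iterate_succ_apply' δ]
    simp only [smul_eq_mul]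
    push_cast
    ring

theorem iterate_mul_of_apply_eq_zero {k A : Type*} [CommRing k] [CommRing A] [Algebra k A]
    (δ : Derivation k A A) {c : A} (hc : δ c = 0) (f : A) (l : ℕ) :
    δ^[l] (c * f) = c * δ^[l] f := by
  induction l with
  | zero => rfl
  | succ l ih =>
    rw [Function.iterate_succ_apply', ih, Derivation.leibniz, hc, smul_zero, add_zero,
      Function.iterate_succ_apply', smul_eq_mul]

theorem iterate_pderiv_char [Fact p.Prime] [CharP K p] (i : Fin n) (f : MvPolynomial (Fin n) K) :
    (pderiv i)^[p] f = 0 := by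
  obtain ⟨l, hl⟩ : ∃ l, p = l + 1 := ⟨p - 1, by
    have := (Fact.out : p.Prime).pos; omega⟩
  induction f using MvPolynomial.induction_on with
  | C a =>
    rw [hl, Function.iterate_succ_apply, pderiv_C]
    exact iterate_map_zero (pderiv i) l
  | add f g hf hg => rw [iterate_map_add (pderiv i), hf, hg, add_zero]
  | mul_X f j hf =>
    have hX : pderiv i (pderiv i (X j : MvPolynomial (Fin n) K)) = 0 := by
      rw [pderiv_X]
      by_cases h : i = j
      · subst h
        rw [Pi.single_eq_same, pderiv_one]
      · rw [Pi.single_eq_of_ne (Ne.symm h), map_zero]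
    have h := iterate_mul_of_apply_apply_eq_zero (pderiv i) hX f l
    rw [← hl, hf, CharP.cast_eq_zero] at h
    rw [mul_comm, h]
    ring

variable (M : Submonoid (MvPolynomial (Fin n) K))

theorem iterate_partialD_algebraMap (i : Fin n) (f : MvPolynomial (Fin n) K) (l : ℕ) :
    (partialD M i)^[l] (algebraMap _ _ f) = algebraMap _ _ ((pderiv i)^[l] f) := by
  induction l generalizing f with
  | zero => rfl
  | succ l ih => rw [Function.iterate_succ_apply, partialD_algebraMap, ih,
      Function.iterate_succ_apply]

/-- A denominator that is a p-th power is constant for all derivations, so statements about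
derivatives reduce to polynomials. -/
theorem exists_pow_mul_eq (hp : p ≠ 0) (a : Fun M) :
    ∃ f : MvPolynomial (Fin n) K, ∃ s ∈ M,
      algebraMap _ (Fun M) s ^ p * a = algebraMap _ (Fun M) f := by
  obtain ⟨⟨f, s⟩, h⟩ := IsLocalization.surj M a
  obtain ⟨l, rfl⟩ := Nat.exists_eq_succ_of_ne_zero hp
  refine ⟨s ^ l * f, s, s.2, ?_⟩
  rw [map_mul, ← h, map_pow, Nat.succ_eq_add_one, pow_succ]
  ring

theorem iterate_partialD_char [Fact p.Prime] [CharP K p] (i : Fin n) (a : Fun M) :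
    (partialD M i)^[p] a = 0 := by
  obtain ⟨f, s, hs, h⟩ := exists_pow_mul_eq M (Fact.out : p.Prime).ne_zero a
  have hu : IsUnit (algebraMap _ (Fun M) s ^ p) := (IsLocalization.map_units (Fun M) ⟨s, hs⟩).pow p
  refine hu.mul_right_eq_zero.1 ?_
  rw [← iterate_mul_of_apply_eq_zero _ (partialD_pow_char M p i _), h,
    iterate_partialD_algebraMap, iterate_pderiv_char, map_zero]

theorem diag_le_nonZeroDivisors : diag n K ≤ nonZeroDivisors (MvPolynomial (Fin n) K) := by
  refine Submonoid.closure_le.2 ?_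
  rintro _ ⟨i, j, hij, rfl⟩
  exact mem_nonZeroDivisors_of_ne_zero (sub_ne_zero.2 fun h => hij (X_injective h))

/-- The derivative in z_i multiplies the coefficient of a monomial by its exponent at i, so all
exponents in the support are divisible by p. -/
theorem algebraMap_mem_powRing [Fact p.Prime] [CharP K p] {f : MvPolynomial (Fin n) K}
    (hf : ∀ i, pderiv i f = 0) : algebraMap _ (Fun M) f ∈ powRing M p := by
  rw [f.as_sum, map_sum]
  refine Subalgebra.sum_mem _ fun m hm => ?_
  have hdvd : ∀ i, p ∣ m i := by
    intro i
    by_contra hnd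
    have hmi : m i ≠ 0 := fun h => hnd (h ▸ dvd_zero p)
    have h := coeff_pderiv (i := i) f (m - Finsupp.single i 1)
    have hle : Finsupp.single i 1 ≤ m := Finsupp.single_le_iff.2 (Nat.one_le_iff_ne_zero.2 hmi)
    rw [hf i, tsub_add_cancel_of_le hle, coeff_zero] at h
    have h1 : (((m - Finsupp.single i 1 : Fin n →₀ ℕ) i + 1 : ℕ) : K) = 0 := by
      push_cast
      exact (mul_eq_zero.1 h.symm).resolve_left (mem_support_iff.1 hm)
    rw [CharP.cast_eq_zero_iff K p] at h1
    refine hnd ?_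
    convert h1 using 1
    simp
    omega
  rw [monomial_eq, map_mul, Finsupp.prod, map_prod]
  refine Subalgebra.mul_mem _ ?_ (Subalgebra.prod_mem _ fun i _ => ?_)
  · exact (powRing M p).algebraMap_mem (coeff m f)
  · obtain ⟨l, hl⟩ := hdvd i
    rw [map_pow, hl, pow_mul]
    have hz : z M i ^ p ∈ powRing M p := Algebra.subset_adjoin (Or.inl ⟨i, rfl⟩)
    exact Subalgebra.pow_mem _ hz l

theorem exists_mul_pow_eq_one [Fact p.Prime] [CharP K p] {M} {s : MvPolynomial (Fin n) K}
    (hM : diag n K ≤ M) (hs : s ∈ diag n K) :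
    ∃ t ∈ powRing M p, t * algebraMap _ (Fun M) s ^ p = 1 := by
  induction hs using Submonoid.closure_induction with
  | mem s hs =>
    obtain ⟨i, j, hij, rfl⟩ := hs
    refine ⟨Ring.inverse (z M i ^ p - z M j ^ p),
      Algebra.subset_adjoin (Or.inr ⟨i, j, hij, rfl⟩), ?_⟩
    have h : algebraMap (MvPolynomial (Fin n) K) (Fun M) (X i - X j) ^ p =
        z M i ^ p - z M j ^ p := by
      rw [← map_pow, sub_pow_char, map_sub, map_pow, map_pow]
      rfl
    rw [← h]
    refine Ring.inverse_mul_cancel _ (IsUnit.pow p ?_)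
    rw [map_sub]
    exact isUnit_z_sub_z hM hij
  | one => exact ⟨1, Subalgebra.one_mem _, by simp⟩
  | mul x y _ _ hx hy =>
    obtain ⟨s, hs, hs'⟩ := hx
    obtain ⟨t, ht, ht'⟩ := hy
    refine ⟨s * t, Subalgebra.mul_mem _ hs ht, ?_⟩
    rw [map_mul, mul_pow, mul_mul_mul_comm, hs', ht', one_mul]

/-- The functions on `S` with zero derivatives. -/
theorem mem_powRing_of_partialD_eq_zero [Fact p.Prime] [CharP K p] {a : Fun (diag n K)}
    (ha : ∀ i, partialD (diag n K) i a = 0) : a ∈ powRing (diag n K) p := by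
  obtain ⟨f, s, hs, h⟩ := exists_pow_mul_eq (diag n K) (Fact.out : p.Prime).ne_zero a
  obtain ⟨t, ht, ht'⟩ := exists_mul_pow_eq_one (p := p) le_rfl hs
  have hf : ∀ i, pderiv i f = 0 := by
    intro i
    refine IsLocalization.injective (Fun (diag n K)) diag_le_nonZeroDivisors ?_
    rw [← partialD_algebraMap, ← h, Derivation.leibniz, partialD_pow_char, ha, map_zero]
    simp
  have : a = t * algebraMap _ (Fun (diag n K)) f := by
    rw [← h, ← mul_assoc, ht', one_mul]
  rw [this]
  exact Subalgebra.mul_mem _ ht (algebraMap_mem_powRing _ hf)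

end Constants

/-! ### Flat sections as a module over the constants -/

section FlatSections

variable {ι κ k A : Type*} [CommRing k] [CommRing A] [Algebra k A] {d : ι → Derivation k A A}
  {V : Type*} [AddCommGroup V] [Module A V]

theorem Connection.nabla_sum_smul (D : Connection d V) [Fintype κ] {b : κ → V}
    (hb : ∀ l, D.IsFlatSection (b l)) (a : κ → A) (i : ι) :
    D.nabla i (∑ l, a l • b l) = ∑ l, d i (a l) • b l := by
  rw [map_sum]
  exact Finset.sum_congr rfl fun l _ => by rw [D.leibniz, hb l i, smul_zero, add_zero]

/-- If all flat sections are combinations of linearly independent flat sections, then these form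
a basis of the module of flat sections over the ring of constants. -/
theorem Connection.exists_basis_flatSections (D : Connection d V) (B : Subalgebra k A)
    (hB : ∀ i, ∀ b ∈ B, d i b = 0) (hconst : ∀ a, (∀ i, d i a = 0) → a ∈ B) [Fintype κ]
    {b : κ → V} (hli : LinearIndependent A b) (hb : ∀ l, D.IsFlatSection (b l))
    (hspan : ∀ v, D.IsFlatSection v → v ∈ Submodule.span A (Set.range b)) :
    ∃ e : Module.Basis κ B (D.flatSections B hB), ∀ l, (e l : V) = b l := by
  rw [Fintype.linearIndependent_iff] at hli
  have hcoe : ∀ g : κ → B, ((∑ l, g l • (⟨b l, hb l⟩ : D.flatSections B hB) :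
      D.flatSections B hB) : V) = ∑ l, (g l : A) • b l := by
    intro g
    rw [AddSubmonoidClass.coe_finsetSum]
    rfl
  refine ⟨Module.Basis.mk (v := fun l => (⟨b l, hb l⟩ : D.flatSections B hB)) ?_ ?_, fun l => ?_⟩
  · rw [Fintype.linearIndependent_iff]
    intro g hg l
    have := hli (fun l => (g l : A)) (by rw [← hcoe, hg]; rfl) l
    exact Subtype.ext this
  · rintro ⟨v, hv⟩ -
    obtain ⟨a, ha⟩ := (Submodule.mem_span_range_iff_exists_fun A).1 (hspan v hv)
    -- Applying ∇ to a combination of flat sections differentiates only the coefficients, and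
    -- independence makes each derivative zero.
    have hda : ∀ l, a l ∈ B := by
      refine fun l => hconst _ fun i => ?_
      refine hli (fun l => d i (a l)) ?_ l
      rw [← D.nabla_sum_smul hb, ha]
      exact hv i
    refine (Submodule.mem_span_range_iff_exists_fun B).2 ⟨fun l => ⟨a l, hda l⟩, Subtype.ext ?_⟩
    rw [hcoe]
    exact ha
  · rw [Module.Basis.mk_apply]

end FlatSections

/-! ### Taylor expansions -/

section Taylor

open Polynomial

/-- Chain rule: the extra term comes from the motion of the center t. -/
theorem coeffD_taylor {k A : Type*} [CommRing k] [CommRing A] [Algebra k A]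
    (δ : Derivation k A A) (t : A) (f : A[X]) :
    coeffD δ (taylor t f) = taylor t (coeffD δ f) + C (δ t) * derivative (taylor t f) := by
  induction f using Polynomial.induction_on' with
  | add f g hf hg =>
    simp only [map_add, hf, hg]
    ring
  | monomial N a =>
    have : coeffD δ (monomial N a) = monomial N (δ a) := by
      ext M
      rw [coeff_coeffD, coeff_monomial, coeff_monomial]
      split_ifs <;> simp
    rw [this, taylor_monomial, taylor_monomial, Derivation.leibniz, Derivation.leibniz_pow,
      map_add, coeffD_X, coeffD_C, coeffD_C, derivative_C_mul, derivative_X_add_C_pow]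
    simp only [smul_eq_mul, nsmul_eq_mul, map_natCast]
    ring

theorem derivation_coeff_taylor {k A : Type*} [CommRing k] [CommRing A] [Algebra k A]
    (δ : Derivation k A A) {t : A} (ht : δ t = 1) (f : A[X]) (m : ℕ) :
    δ ((taylor t f).coeff m) =
      (taylor t (coeffD δ f)).coeff m + (m + 1) * (taylor t f).coeff (m + 1) := by
  rw [← coeff_coeffD, coeffD_taylor, ht, C_1, one_mul, coeff_add, coeff_derivative, mul_comm]

theorem derivative_taylor {A : Type*} [CommRing A] (t : A) (f : A[X]) :
    derivative (taylor t f) = taylor t (derivative f) := by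
  rw [taylor_apply, taylor_apply, derivative_comp]
  simp

/-- A sequence that satisfies the differential recursion of the Taylor coefficients at `x = z_i`
of `∑ v_j P ^ m / (x - z_j)`, for flat `v`, is given by derivatives of its first term. -/
theorem taylor_recursion {k A : Type*} [CommRing k] [CommRing A] [Algebra k A]
    (δ : Derivation k A A) {Y β c : ℕ → A} {v : A} {a b : ℕ}
    (hβ : ∀ r : ℕ, δ (β r) = (r + 1) * β (r + 1)) (hY0 : Y 0 = v * β 0)
    (hY : ∀ r : ℕ, δ (Y r) = (a + r + 1) * (Y (r + 1) - v * β (r + 1)))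
    (hδc : ∀ r, δ (c r) = 0) (hc0 : c 0 = 1)
    (hc : ∀ r ≤ b, (a + r + 1) * c (r + 1) = c r) (hu : ∀ r : ℕ, r ≤ b → IsUnit (a + r + 1 : A))
    {r : ℕ} (hr : r ≤ b + 1) :
    Y r = (a + r + 1) * ∑ l ∈ Finset.range r, c (l + 1) * (β (r - l) * δ^[l] v) +
      c r * (β 0 * δ^[r] v) := by
  induction r with
  | zero => simp [hY0, hc0, mul_comm]
  | succ r ih =>
    have ih := ih (by omega)
    refine (hu r (by omega)).mul_left_cancel ?_
    have h1 := hY r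
    rw [ih] at h1
    rw [map_add, Derivation.leibniz, map_sum, Derivation.leibniz, hδc,
      Derivation.leibniz] at h1
    have hcst : δ ((a : A) + r + 1) = 0 := by simp
    rw [hcst, hβ, ← Function.iterate_succ_apply' δ] at h1
    have hterm : ∀ l ∈ Finset.range r, δ (c (l + 1) * (β (r - l) * δ^[l] v)) =
        ((r : A) - l + 1) * (c (l + 1) * (β (r + 1 - l) * δ^[l] v)) +
          c (l + 1) * (β (r + 1 - (l + 1)) * δ^[l + 1] v) := by
      intro l hl
      have hl := Finset.mem_range.1 hl
      rw [Derivation.leibniz, hδc, Derivation.leibniz, hβ, ← Function.iterate_succ_apply' δ,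
        Nat.cast_sub hl.le, Nat.sub_add_comm hl.le, Nat.add_sub_add_right]
      simp only [smul_eq_mul]
      ring
    rw [Finset.sum_congr rfl hterm, Finset.sum_add_distrib] at h1
    -- Two ways to split off the end terms of ∑_{l≤r} c_l β_(r+1-l) δ^l v; this absorbs the sum in
    -- which δ has raised the order of differentiation.
    have hshift := Finset.sum_range_succ' (fun l => c l * (β (r + 1 - l) * δ^[l] v)) r
    rw [Finset.sum_range_succ] at hshift
    have hcomb : ((a : A) + (r + 1 : ℕ) + 1) *
          ∑ l ∈ Finset.range (r + 1), c (l + 1) * (β (r + 1 - l) * δ^[l] v) =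
        ∑ l ∈ Finset.range (r + 1), ((r : A) - l + 1) * (c (l + 1) * (β (r + 1 - l) * δ^[l] v)) +
        ∑ l ∈ Finset.range (r + 1), c l * (β (r + 1 - l) * δ^[l] v) := by
      rw [Finset.mul_sum, ← Finset.sum_add_distrib]
      refine Finset.sum_congr rfl fun l hl => ?_
      rw [← hc l (by have := Finset.mem_range.1 hl; omega)]
      push_cast
      ring
    rw [hcomb, Finset.sum_range_succ, Finset.sum_range_succ _ r]
    simp only [smul_eq_mul, Nat.sub_zero, Function.iterate_zero, id_eq, hc0, Nat.add_sub_cancel_left,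
      mul_zero, add_zero, zero_add, Nat.cast_zero] at h1 hshift ⊢
    rw [← hc r (by omega)] at h1 hshift ⊢
    linear_combination (-1) * h1 - (a + r + 1 : A) * hshift

/-- The Taylor coefficient of order `p - 1` in characteristic `p`. -/
theorem coeff_taylor_char {A : Type*} [CommRing A] {p : ℕ} [Fact p.Prime] [CharP A p] (t : A)
    {f : A[X]} {D : ℕ} (hf : f.natDegree < D) :
    (taylor t f).coeff (p - 1) =
      ∑ l ∈ Finset.range (D / p), t ^ (p * l) * f.coeff ((l + 1) * p - 1) := by
  have hp : 0 < p := (Fact.out : p.Prime).pos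
  -- Lucas: modulo p, the binomial coefficient of i over p - 1 is 1 if i ≡ -1 and 0 otherwise.
  have hch : ∀ i : ℕ, ((i.choose (p - 1) : ℕ) : A) = if i % p = p - 1 then 1 else 0 := by
    intro i
    have h := (CharP.natCast_eq_natCast A p).2
      (Choose.choose_modEq_choose_mod_mul_choose_div_nat (n := i) (k := p - 1) (p := p))
    rw [h, Nat.mod_eq_of_lt (by omega : p - 1 < p), Nat.div_eq_of_lt (by omega : p - 1 < p),
      Nat.choose_zero_right, mul_one]
    split_ifs with hi
    · rw [hi, Nat.choose_self, Nat.cast_one]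
    · have := Nat.mod_lt i hp
      rw [Nat.choose_eq_zero_of_lt (by omega), Nat.cast_zero]
  rw [taylor_coeff, hasseDeriv_apply, sum_over_range' _ (by simp) D hf, eval_finsetSum]
  symm
  refine Finset.sum_of_injOn (fun l => (l + 1) * p - 1) ?_ ?_ ?_ ?_
  · intro l _ l' _ h
    have h1 : 0 < (l + 1) * p := Nat.mul_pos l.succ_pos hp
    have h2 : 0 < (l' + 1) * p := Nat.mul_pos l'.succ_pos hp
    have h3 : (l + 1) * p = (l' + 1) * p := by
      simp only at h
      omega
    have := Nat.eq_of_mul_eq_mul_right hp h3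
    omega
  · intro l hl
    have h1 : 0 < (l + 1) * p := Nat.mul_pos l.succ_pos hp
    have h2 : (l + 1) * p ≤ D := (Nat.le_div_iff_mul_le hp).1 (by
      have := Finset.mem_range.1 (Finset.mem_coe.1 hl)
      omega)
    exact Finset.mem_coe.2 (Finset.mem_range.2 (by simp only; omega))
  · intro i hi hne
    rw [hch, if_neg, zero_mul, monomial_zero_right, eval_zero]
    intro hmod
    refine hne ⟨i / p, ?_, ?_⟩
    · refine Finset.mem_coe.2 (Finset.mem_range.2 ?_)
      rw [Nat.lt_iff_add_one_le, Nat.le_div_iff_mul_le hp]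
      have := Nat.div_add_mod i p
      have := Finset.mem_range.1 hi
      rw [add_mul, mul_comm (i / p)]
      omega
    · have := Nat.div_add_mod i p
      simp only [add_mul, mul_comm (i / p)]
      omega
  · intro l _
    have h1 : 0 < (l + 1) * p := Nat.mul_pos l.succ_pos hp
    have h2 : (l + 1) * p - 1 = p - 1 + p * l := by
      rw [add_mul, mul_comm l] at h1 ⊢
      omega
    rw [hch, h2, Nat.add_mul_mod_self_left, Nat.mod_eq_of_lt (by omega), if_pos rfl, one_mul,
      eval_monomial, Nat.add_sub_cancel_left, mul_comm]

end Taylor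

/-! ### A nonvanishing derivative -/

section Nonvanishing

open Polynomial

/-- The shifts are chosen one at a time. The bound h < p keeps the binomial coefficients nonzero,
and an infinite field has room to avoid the roots of a nonzero polynomial. -/
theorem exists_coeff_prod_ne_zero {L ι : Type*} [Field L] [Infinite L] {p : ℕ} [Fact p.Prime]
    [CharP L p] {h : ℕ} (hp : h < p) (S : Finset ι) {m : ℕ} (hm : m ≤ h * S.card) :
    ∃ σ : ι → L, (∏ s ∈ S, (X + C (σ s)) ^ h).coeff m ≠ 0 := by
  classical
  induction S using Finset.induction_on generalizing m with
  | empty =>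
    have : m = 0 := by simpa using hm
    exact ⟨0, by simp [this]⟩
  | insert a S ha ih =>
    rw [Finset.card_insert_of_notMem ha, Nat.mul_succ] at hm
    set r := min m h with hr
    obtain ⟨σ, hσ⟩ := ih (m := m - r) (by omega)
    set f := ∏ s ∈ S, (X + C (σ s)) ^ h with hf
    -- The coefficient in question as a polynomial in the new shift y. Its coefficient at y^(h-r)
    -- involves only the term (m - r, r), which is nonzero by induction.
    set g : L[X] := ∑ x ∈ Finset.HasAntidiagonal.antidiagonal m,
      C (f.coeff x.1 * (h.choose x.2 : ℕ)) * X ^ (h - x.2) with hg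
    have hg0 : g ≠ 0 := by
      intro h0
      have h1 := congrArg (fun q => q.coeff (h - r)) h0
      simp only [hg, finsetSum_coeff, coeff_C_mul_X_pow, coeff_zero] at h1
      rw [Finset.sum_eq_single (m - r, r)] at h1
      · rw [if_pos rfl] at h1
        refine (mul_ne_zero hσ ?_) h1
        rw [Ne, CharP.cast_eq_zero_iff L p]
        exact ((Fact.out : p.Prime).coprime_iff_not_dvd).1
          ((Fact.out : p.Prime).coprime_choose_of_lt hp (by omega))
      · rintro ⟨u, w⟩ huw hne
        rw [Finset.HasAntidiagonal.mem_antidiagonal] at huw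
        simp only at huw
        by_cases hw : w ≤ h
        · rw [if_neg]
          intro h2
          refine hne (Prod.ext ?_ ?_) <;> simp only <;> omega
        · rw [Nat.choose_eq_zero_of_lt (by omega)]
          simp
      · intro h2
        exact absurd (Finset.HasAntidiagonal.mem_antidiagonal.2 (by omega)) h2
    obtain ⟨y, hy⟩ : ∃ y, g.eval y ≠ 0 := by
      by_contra hcon
      push Not at hcon
      exact hg0 (Polynomial.funext fun y => by rw [hcon y, eval_zero])
    refine ⟨Function.update σ a y, ?_⟩
    rw [Finset.prod_insert ha, Function.update_self]
    have hS : ∏ s ∈ S, (X + C (Function.update σ a y s)) ^ h = f :=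
      Finset.prod_congr rfl fun s hs => by
        rw [Function.update_of_ne (ne_of_mem_of_not_mem hs ha)]
    rw [hS, mul_comm, coeff_mul]
    convert hy using 1
    rw [hg, eval_finsetSum]
    refine Finset.sum_congr rfl fun x _ => ?_
    rw [coeff_X_add_C_pow, eval_C_mul, eval_pow, eval_X]
    ring

variable {n : ℕ} {K : Type*} [Field K] {p : ℕ} [Fact p.Prime] [CharP K p]

/-- The hypothesis p ≤ n(b+1) says a + 1 ≤ (n-1)(b+1), so the derivative does not exceed the degree
in z_i. Specializing the other variables over the algebraic closure, its value at 0 is (a+1)! times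
a coefficient that can be made nonzero. -/
theorem iterate_pderiv_prod_ne_zero {a b : ℕ} (hab : a + 1 + (b + 1) = p) {i : Fin n}
    (hn : p ≤ n * (b + 1)) :
    (MvPolynomial.pderiv i)^[a + 1]
      ((∏ s ∈ Finset.univ.erase i, (MvPolynomial.X i - MvPolynomial.X s :
        MvPolynomial (Fin n) K)) ^ (b + 1)) ≠ 0 := by
  set L := AlgebraicClosure K
  have hchar : CharP L p := charP_of_injective_algebraMap (algebraMap K L).injective p
  obtain ⟨σ, hσ⟩ := exists_coeff_prod_ne_zero (L := L) (p := p) (h := b + 1) (by omega)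
    (Finset.univ.erase i) (m := a + 1) (by
      rw [Finset.card_erase_of_mem (Finset.mem_univ i), Finset.card_univ, Fintype.card_fin,
        Nat.mul_sub, mul_comm, mul_one]
      omega)
  set ψ : MvPolynomial (Fin n) K →ₐ[K] L[X] :=
    MvPolynomial.aeval fun s => if s = i then X else -C (σ s) with hψ
  have hcomm : ∀ f, ψ (MvPolynomial.pderiv i f) = derivative (ψ f) := by
    intro f
    induction f using MvPolynomial.induction_on with
    | C x =>
      rw [MvPolynomial.pderiv_C, map_zero, hψ, MvPolynomial.aeval_C,
        IsScalarTower.algebraMap_apply K L L[X], ← Polynomial.C_eq_algebraMap, derivative_C]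
    | add f g hf hg => simp only [map_add, hf, hg]
    | mul_X f j hf =>
      rw [Derivation.leibniz, map_add, smul_eq_mul, smul_eq_mul, map_mul, map_mul, hf, map_mul,
        derivative_mul, MvPolynomial.pderiv_X]
      have hX : ψ (MvPolynomial.X j) = if j = i then X else -C (σ j) := by
        rw [hψ, MvPolynomial.aeval_X]
      rw [hX]
      by_cases hj : j = i
      · subst hj
        simp
        ring
      · rw [Pi.single_eq_of_ne hj]
        simp [hj]
        ring
  have hiter : ∀ (l : ℕ) f, ψ ((MvPolynomial.pderiv i)^[l] f) = derivative^[l] (ψ f) := by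
    intro l
    induction l with
    | zero => intro f; rfl
    | succ l ih => intro f; rw [Function.iterate_succ_apply, ih, hcomm, Function.iterate_succ_apply]
  intro h0
  have h1 := congrArg (fun f => (ψ f).coeff 0) h0
  simp only [hiter, map_zero, coeff_zero, map_pow, map_prod, map_sub] at h1
  have h2 : ∀ s ∈ Finset.univ.erase i, ψ (MvPolynomial.X i) - ψ (MvPolynomial.X s) =
      X + C (σ s) := by
    intro s hs
    rw [hψ, MvPolynomial.aeval_X, MvPolynomial.aeval_X, if_pos rfl,
      if_neg (Finset.ne_of_mem_erase hs), sub_neg_eq_add]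
  rw [Finset.prod_congr rfl h2, ← Finset.prod_pow, coeff_iterate_derivative, zero_add,
    Nat.descFactorial_self, nsmul_eq_mul] at h1
  refine mul_ne_zero ?_ hσ h1
  rw [Ne, CharP.cast_eq_zero_iff L p, (Fact.out : p.Prime).dvd_factorial]
  omega

end Nonvanishing

/-! ### Flat sections are orthogonal to the solutions with the opposite parameter -/

section FlatOrthogonal

open Polynomial

variable {n : ℕ} {K : Type*} [Field K] {M : Submonoid (MvPolynomial (Fin n) K)} {p : ℕ}
  [CharP K p]

theorem coeffD_map_algebraMap (i : Fin n) (f : Polynomial (MvPolynomial (Fin n) K)) :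
    coeffD (partialD M i) (f.map (algebraMap _ (Fun M))) =
      (coeffD (MvPolynomial.pderiv i) f).map (algebraMap _ (Fun M)) := by
  ext N
  rw [coeff_coeffD, coeff_map, coeff_map, coeff_coeffD, partialD_algebraMap]

theorem partialD_z_self (i : Fin n) : partialD M i (z M i) = 1 := by
  rw [z, partialD_algebraMap, MvPolynomial.pderiv_X_self, map_one]

/-- The generating polynomial of the pairings of `v` with the coefficient vectors of
`P ^ m / (x - z_j)`. -/
def pairingPoly (M : Submonoid (MvPolynomial (Fin n) K)) (m : ℕ) (v : Fin n → Fun M) :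
    (Fun M)[X] :=
  ∑ j, C (v j) * (Q n K m j).map (algebraMap _ (Fun M))

theorem coeff_pairingPoly (m : ℕ) (v : Fin n → Fun M) (N : ℕ) :
    (pairingPoly M m v).coeff N = ∑ j, v j * algebraMap _ (Fun M) ((Q n K m j).coeff N) := by
  simp [pairingPoly, finsetSum_coeff]

/-- For flat v only the action of ∇_i on the coefficient vectors contributes, and that is
concentrated in the i-th coordinate. -/
theorem coeffD_pairingPoly (hM : diag n K ≤ M) {m : ℕ} (hm : m + 1 < p) {i : Fin n}
    {v : Fin n → Fun M} (hv : nablaVec M (-((m + 1 : ℕ) : K)) i v = 0) :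
    coeffD (partialD M i) (pairingPoly M (m + 1) v) =
      -(C (v i) * derivative ((Q n K (m + 1) i).map (algebraMap _ (Fun M)))) := by
  ext N
  rw [coeff_coeffD, coeff_pairingPoly, partialD_sum_mul M (-((m + 1 : ℕ) : K)), hv, neg_neg,
    nablaVec_coeff_Q hM (natCast_succ_ne_zero (p := p) hm), coeff_neg, coeff_C_mul,
    coeff_derivative, coeff_map]
  simp [Pi.single_apply]
  ring

variable [Fact p.Prime]

/-- Initial value of the Taylor recursion: for j ≠ i the factor (x - z_i)^(m+1) divides Q_j, so only
j = i contributes in order m. -/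
theorem coeff_taylor_pairingPoly (m : ℕ) (v : Fin n → Fun M) (i : Fin n) :
    (taylor (z M i) (pairingPoly M (m + 1) v)).coeff m =
      v i * (taylor (z M i) (((masterErase n K i).map (algebraMap _ (Fun M))) ^ (m + 1))).coeff 0 := by
  have hterm : ∀ j, ∃ g : (Fun M)[X], (Q n K (m + 1) j).map (algebraMap _ (Fun M)) =
      (X - C (z M i)) ^ m * g ∧ (j ≠ i → g.eval (z M i) = 0) ∧
      (j = i → g = ((masterErase n K i).map (algebraMap _ (Fun M))) ^ (m + 1)) := by
    intro j
    refine ⟨(masterErase n K i ^ m * masterErase n K j).map (algebraMap _ (Fun M)), ?_, ?_, ?_⟩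
    · rw [Q_eq, ← mul_masterErase i]
      simp only [mul_pow, Polynomial.map_mul, Polynomial.map_pow, Polynomial.map_sub, map_X, map_C]
      rw [mul_assoc]
      rfl
    · intro hij
      rw [eval_map, eval₂_mul]
      refine mul_eq_zero_of_right _ ?_
      rw [masterErase, eval₂_finsetProd]
      exact Finset.prod_eq_zero (Finset.mem_erase.2 ⟨hij.symm, Finset.mem_univ i⟩) (by
        simp [eval₂_sub, z])
    · rintro rfl
      rw [← pow_succ, Polynomial.map_pow]
  choose g hg hg0 hg1 using hterm
  have htaylor : taylor (z M i) (X - C (z M i)) = X := by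
    rw [map_sub, taylor_X, taylor_C, add_sub_cancel_right]
  have hcoeff : ∀ j, (taylor (z M i) (C (v j) * (Q n K (m + 1) j).map
      (algebraMap _ (Fun M)))).coeff m = v j * (g j).eval (z M i) := by
    intro j
    rw [hg, taylor_mul, taylor_mul, taylor_pow, taylor_C, htaylor, coeff_C_mul,
      coeff_X_pow_mul', if_pos le_rfl, Nat.sub_self, taylor_coeff_zero]
  rw [pairingPoly, map_sum, finsetSum_coeff, Finset.sum_eq_single i]
  · rw [hcoeff, hg1 i rfl, taylor_coeff_zero]
  · intro j _ hj
    rw [hcoeff, hg0 j hj, mul_zero]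
  · exact fun h => absurd (Finset.mem_univ i) h

theorem coeff_taylor_Q (m r : ℕ) (i : Fin n) :
    (taylor (z M i) ((Q n K (m + 1) i).map (algebraMap _ (Fun M)))).coeff (m + r) =
      (taylor (z M i) (((masterErase n K i).map (algebraMap _ (Fun M))) ^ (m + 1))).coeff r := by
  have h : (Q n K (m + 1) i).map (algebraMap _ (Fun M)) =
      (X - C (z M i)) ^ m * ((masterErase n K i).map (algebraMap _ (Fun M))) ^ (m + 1) := by
    rw [Q_eq, ← mul_masterErase i]
    simp only [mul_pow, Polynomial.map_mul, Polynomial.map_pow, Polynomial.map_sub, map_X, map_C]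
    rw [mul_assoc, ← pow_succ]
    rfl
  rw [h, taylor_mul, taylor_pow, map_sub, taylor_X, taylor_C, add_sub_cancel_right,
    coeff_X_pow_mul', if_pos (Nat.le_add_right _ _), Nat.add_sub_cancel_left]

variable (hM : diag n K ≤ M) (hM' : M ≤ nonZeroDivisors (MvPolynomial (Fin n) K)) {a b : ℕ}
  (hab : a + 1 + (b + 1) = p)

include hM hM' hab in
theorem coeff_taylor_pairingPoly_char (hn : p ≤ n * (b + 1)) {v : Fin n → Fun M} {i : Fin n}
    (hv : nablaVec M (-((a + 1 : ℕ) : K)) i v = 0) :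
    (taylor (z M i) (pairingPoly M (a + 1) v)).coeff (p - 1) = 0 := by
  have hdom : IsDomain (Fun M) := IsLocalization.isDomain_of_le_nonZeroDivisors (Fun M) hM'
  set δ := partialD M i with hδ
  set t := z M i with ht
  set B := (masterErase n K i).map (algebraMap _ (Fun M)) with hB
  have hδB : coeffD δ (B ^ (a + 1)) = 0 := by
    rw [Derivation.leibniz_pow, hB, coeffD_map_algebraMap, coeffD_masterErase]
    simp
  have hcK : ∀ r ≤ b, ((a + r + 1 : ℕ) : K) ≠ 0 := fun r hr =>
    natCast_succ_ne_zero (p := p) (by omega)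
  -- The inverse products come from solving the recursion up to order p - 1; the factors a + s + 1
  -- with s ≤ b are less than p, hence invertible.
  set c : ℕ → Fun M := fun r =>
    algebraMap K (Fun M) (∏ s ∈ Finset.range r, ((a + s + 1 : ℕ) : K))⁻¹ with hc
  have hcast : ∀ r : ℕ, ((a : Fun M) + r + 1) = algebraMap K (Fun M) ((a + r + 1 : ℕ) : K) := by
    intro r
    rw [map_natCast]
    push_cast
    ring
  set Y : ℕ → Fun M := fun r => (taylor t (pairingPoly M (a + 1) v)).coeff (a + r) with hYdef
  set β : ℕ → Fun M := fun r => (taylor t (B ^ (a + 1))).coeff r with hβdef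
  have hY : ∀ r : ℕ, δ (Y r) = ((a : Fun M) + r + 1) * (Y (r + 1) - v i * β (r + 1)) := by
    intro r
    have h1 := coeff_taylor_Q (M := M) (K := K) a (r + 1) i
    rw [← add_assoc] at h1
    simp only [hYdef, hβdef]
    rw [derivation_coeff_taylor δ (partialD_z_self i), coeffD_pairingPoly (p := p) hM (by omega) hv,
      map_neg, taylor_mul, taylor_C, ← derivative_taylor, coeff_neg, coeff_C_mul, coeff_derivative,
      ← add_assoc, h1]
    push_cast
    ring
  have hrec := taylor_recursion δ (Y := Y) (β := β) (c := c) (v := v i) (a := a) (b := b)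
    (fun r => by
      simp only [hβdef]
      rw [derivation_coeff_taylor δ (partialD_z_self i), hδB, map_zero, coeff_zero, zero_add])
    (coeff_taylor_pairingPoly a v i) hY (fun r => Derivation.map_algebraMap _ _)
    (by simp [hc]) (fun r hr => by
      simp only [hc]
      rw [hcast, ← map_mul, Finset.prod_range_succ, mul_inv, mul_left_comm,
        mul_inv_cancel₀ (hcK r hr), mul_one])
    (fun r hr => by
      rw [hcast]
      exact ((hcK r hr).isUnit).map _) (r := b + 1) le_rfl
  -- At r = b + 1 the factor a + r + 1 is p = 0. The sum in the solved recursion disappears, leaving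
  -- a multiple of the (b+1)-st derivative of v_i, and Y (b + 1) is itself killed by δ.
  have hp0 : ((a : Fun M) + (b + 1 : ℕ) + 1) = 0 := by
    rw [hcast, show a + (b + 1) + 1 = p by omega, CharP.cast_eq_zero K p, map_zero]
  rw [hp0, zero_mul, zero_add] at hrec
  have hδY : δ (Y (b + 1)) = 0 := by rw [hY, hp0, zero_mul]
  have hYp : Y (b + 1) = (taylor t (pairingPoly M (a + 1) v)).coeff (p - 1) := by
    simp only [hYdef]
    congr 1
    omega
  rw [← hYp]
  set π := B.eval t with hπ
  have hβ0 : β 0 = π ^ (a + 1) := by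
    simp only [hβdef]
    rw [taylor_coeff_zero, eval_pow]
  -- Multiplication by π^(b+1) completes π^(a+1) to the constant π^p. Then δ^(a+1) produces δ^p v_i
  -- = 0 on the right and passes Y (b + 1) on the left.
  have hmul : Y (b + 1) * π ^ (b + 1) = c (b + 1) * π ^ p * δ^[b + 1] (v i) := by
    rw [hrec, hβ0, ← hab, pow_add]
    ring
  have h0 := congrArg (δ^[a + 1]) hmul
  rw [iterate_mul_of_apply_eq_zero δ hδY, iterate_mul_of_apply_eq_zero δ (by
      rw [Derivation.leibniz, partialD_pow_char, Derivation.map_algebraMap]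
      simp), ← Function.iterate_add_apply, hab, iterate_partialD_char (p := p), mul_zero] at h0
  refine (mul_eq_zero.1 h0).resolve_right ?_
  have hπ' : π = algebraMap _ (Fun M) (∏ s ∈ Finset.univ.erase i,
      (MvPolynomial.X i - MvPolynomial.X s : MvPolynomial (Fin n) K)) := by
    rw [hπ, hB, eval_map, masterErase, eval₂_finsetProd, map_prod]
    refine Finset.prod_congr rfl fun s _ => ?_
    rw [eval₂_sub, eval₂_X, eval₂_C, map_sub]
    rfl
  rw [hπ', ← map_pow, iterate_partialD_algebraMap]
  exact (map_ne_zero_iff _ (IsLocalization.injective (Fun M) hM')).2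
    (iterate_pderiv_prod_ne_zero hab hn)

include hM hM' hab in
/-- Flat sections of the KZ connection are orthogonal to the `p`-hypergeometric solutions with the
opposite parameter, unless there are no `p`-hypergeometric solutions. -/
theorem sum_mul_hypergeom_eq_zero (hn : p ≤ n * (b + 1)) (hpn : ¬ p ∣ n) {v : Fin n → Fun M}
    (hv : ∀ i, nablaVec M (-((a + 1 : ℕ) : K)) i v = 0) (k : Fin (n * (a + 1) / p)) :
    ∑ j, v j * hypergeom M p (a + 1) k j = 0 := by
  have hdom : IsDomain (Fun M) := IsLocalization.isDomain_of_le_nonZeroDivisors (Fun M) hM'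
  have hchar : CharP (Fun M) p :=
    charP_of_injective_ringHom (algebraMap K (Fun M)).injective p
  set Y := pairingPoly M (a + 1) v with hY
  have hcoeff : ∀ l : ℕ, Y.coeff ((l + 1) * p - 1) = ∑ j, v j * hypergeom M p (a + 1) l j :=
    fun l => coeff_pairingPoly _ _ _
  have hpos : 0 < n * (a + 1) := Nat.mul_pos
    (Nat.pos_of_ne_zero fun h => hpn (h ▸ dvd_zero p)) a.succ_pos
  have hdeg : Y.natDegree < n * (a + 1) := by
    rw [Nat.lt_iff_le_pred hpos]
    refine natDegree_sum_le_of_forall_le _ _ fun j _ => ?_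
    refine (natDegree_C_mul_le _ _).trans (natDegree_map_le.trans ?_)
    rw [Q, natDegree_divByMonic _ (monic_X_sub_C _), natDegree_X_sub_C]
    refine Nat.sub_le_sub_right (natDegree_pow_le.trans ?_) 1
    rw [mul_comm]
    refine Nat.mul_le_mul_right _ ?_
    rw [masterP, natDegree_prod_of_monic _ _ fun s _ => monic_X_sub_C _]
    simp
  -- The Taylor coefficient of order p - 1 at z_i is the value of f at z_i^p, so f has n distinct
  -- roots, while its degree is less than n.
  set f : (Fun M)[X] := ∑ l ∈ Finset.range (n * (a + 1) / p),
    C (Y.coeff ((l + 1) * p - 1)) * X ^ l with hf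
  have hroot : ∀ i, f.eval (z M i ^ p) = 0 := by
    intro i
    have h := coeff_taylor_pairingPoly_char hM hM' hab hn (hv i)
    rw [coeff_taylor_char _ hdeg] at h
    rw [← h, hf, eval_finsetSum]
    refine Finset.sum_congr rfl fun l _ => ?_
    rw [eval_C_mul, eval_pow, eval_X, pow_mul, mul_comm]
  have hinj : Function.Injective fun i => z M i ^ p := by
    intro i j hij
    by_contra hne
    have h := (isUnit_z_sub_z hM hne).pow p
    rw [sub_pow_char] at h
    exact h.ne_zero (sub_eq_zero.2 hij)
  have hf0 : f = 0 := by
    refine eq_zero_of_natDegree_lt_card_of_eval_eq_zero f hinj hroot ?_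
    rw [Fintype.card_fin]
    have h1 := div_add_div_add_one hab hpn
    have h2 : f.natDegree ≤ n * (a + 1) / p - 1 :=
      natDegree_sum_le_of_forall_le _ _ fun l hl =>
        (natDegree_C_mul_X_pow_le _ _).trans (by have := Finset.mem_range.1 hl; omega)
    generalize n * (a + 1) / p = d at h1 h2
    generalize n * (b + 1) / p = e at h1
    omega
  have h := congrArg (fun g => g.coeff k) hf0
  simp only [hf, finsetSum_coeff, coeff_C_mul_X_pow, coeff_zero] at h
  rw [Finset.sum_ite_eq, if_pos (Finset.mem_range.2 k.2), hcoeff] at h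
  exact h

end FlatOrthogonal

/-! ### Connections with an exact pair of systems of flat sections -/

section Abstract

variable {ι κ k A : Type*} [CommRing k] [CommRing A] [Algebra k A] {d : ι → Derivation k A A}
  {V : Type*} [AddCommGroup V] [Module A V]

theorem exists_basis_quotient [Finite κ] (U : Submodule A V) (φ : κ → Module.Dual A V)
    (hsurj : ∀ g : κ → A, ∃ v, ∀ l, φ l v = g l) (hker : ∀ v, v ∈ U ↔ ∀ l, φ l v = 0) :
    ∃ β : Module.Basis κ A (V ⧸ U), ∀ l v, β.coord l (U.mkQ v) = φ l v := by
  have hU : U = LinearMap.ker (LinearMap.pi φ) := by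
    ext v
    rw [hker, LinearMap.mem_ker, funext_iff]
    rfl
  refine ⟨Module.Basis.ofEquivFun ((Submodule.quotEquivOfEq U _ hU).trans
    ((LinearMap.pi φ).quotKerEquivOfSurjective fun g => ?_)), fun l v => ?_⟩
  · obtain ⟨v, hv⟩ := hsurj g
    exact ⟨v, funext hv⟩
  · rw [Module.Basis.coord_apply, Module.Basis.ofEquivFun_repr_apply]
    rfl

theorem Connection.isFlatSection_dual_quotient (D : Connection d V) {U : Submodule A V}
    (hU : D.Preserves U) {φ : Module.Dual A V} (hφ : D.dual.IsFlatSection φ)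
    {c : Module.Dual A (V ⧸ U)} (hc : ∀ v, c (U.mkQ v) = φ v) :
    (D.quotient U hU).dual.IsFlatSection c := by
  intro i
  refine LinearMap.ext fun w => ?_
  obtain ⟨v, rfl⟩ := U.mkQ_surjective w
  change d i (c (U.mkQ v)) - c ((D.quotient U hU).nabla i (U.mkQ v)) = 0
  rw [D.quotient_mkQ, hc, hc]
  exact LinearMap.congr_fun (hφ i) v

/-- The pairings of a basis with its coordinates are 0 or 1, so their derivatives vanish and flat
coordinates force a flat basis. -/
theorem Connection.isFlatSection_of_coord (D : Connection d V) (β : Module.Basis κ A V)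
    (hβ : ∀ l, D.dual.IsFlatSection (β.coord l)) (l : κ) : D.IsFlatSection (β l) := by
  classical
  intro i
  refine β.ext_elem fun l' => ?_
  have h : d i (β.coord l' (β l)) - β.coord l' (D.nabla i (β l)) = 0 :=
    LinearMap.congr_fun (hβ l' i) (β l)
  rw [Module.Basis.coord_apply, Module.Basis.repr_self, Finsupp.single_apply, sub_eq_zero] at h
  rw [map_zero, Finsupp.zero_apply]
  refine h.symm.trans ?_
  split_ifs <;> simp

theorem Connection.preserves_span (D : Connection d V) [Fintype κ] {b : κ → V}
    (hb : ∀ l, D.IsFlatSection (b l)) : D.Preserves (Submodule.span A (Set.range b)) := by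
  intro i u hu
  obtain ⟨a, rfl⟩ := (Submodule.mem_span_range_iff_exists_fun A).1 hu
  rw [D.nabla_sum_smul hb]
  exact (Submodule.mem_span_range_iff_exists_fun A).2 ⟨_, rfl⟩

end Abstract

/-! ### The solutions as sections of the KZ bundle, and the final assembly -/

section Assembly

variable {n : ℕ} {K : Type*} [Field K] {M : Submonoid (MvPolynomial (Fin n) K)} {p : ℕ}
  [CharP K p]

theorem KZ_isFlatSection_iff (c : K) (v : sections M) :
    (KZ M c).IsFlatSection v ↔ ∀ i, nablaVec M c i v = 0 :=
  forall_congr' fun _ => Subtype.ext_iff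

/-- The Shapovalov form maps flat sections to flat functionals for the opposite parameter. -/
theorem shapovalov_isFlatSection {c : K} {y : sections M} (hy : (KZ M (-c)).IsFlatSection y) :
    (KZ M c).dual.IsFlatSection (shapovalov M y) := by
  intro i
  refine LinearMap.ext fun v => ?_
  change partialD M i (∑ j, v.1 j * y.1 j) - ∑ j, nablaVec M c i v.1 j * y.1 j = 0
  rw [partialD_sum_mul M c, (KZ_isFlatSection_iff _ _).1 hy]
  simp

variable [Fact p.Prime]

/-- A `p`-hypergeometric solution as a section. -/
def hypergeomSection (M : Submonoid (MvPolynomial (Fin n) K)) {m : ℕ} (hm : m + 1 < p) (k : ℕ) :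
    sections M :=
  ⟨hypergeom M p (m + 1) k, (mem_sections M).2 (sum_hypergeom hm k)⟩

theorem hypergeomSection_isFlatSection (hM : diag n K ≤ M) {m : ℕ} (hm : m + 1 < p) (k : ℕ) :
    (KZ M ((m + 1 : ℕ) : K)).IsFlatSection (hypergeomSection M hm k) :=
  (KZ_isFlatSection_iff _ _).2 (nablaVec_hypergeom hM hm k)

theorem hypergeomSection_linearIndependent (hM : diag n K ≤ M) (hn : ¬ p ∣ n) {a b : ℕ}
    (hab : a + 1 + (b + 1) = p) (ha : a + 1 < p) :
    LinearIndependent (Fun M) fun k : Fin (n * (a + 1) / p) => hypergeomSection M ha k :=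
  LinearIndependent.of_comp (sections M).subtype (hypergeom_exact hM hn hab).1

theorem mem_span_hypergeomSection_iff (hM : diag n K ≤ M) (hn : ¬ p ∣ n) {a b : ℕ}
    (hab : a + 1 + (b + 1) = p) (ha : a + 1 < p) (hb : b + 1 < p) (v : sections M) :
    v ∈ Submodule.span (Fun M)
        (Set.range fun k : Fin (n * (a + 1) / p) => hypergeomSection M ha k) ↔
      ∀ l : Fin (n * (b + 1) / p), shapovalov M (hypergeomSection M hb l) v = 0 := by
  constructor
  · intro hv l
    induction hv using Submodule.span_induction with
    | mem x hx =>
      obtain ⟨k, rfl⟩ := hx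
      exact sum_hypergeom_mul hab k l
    | zero => exact map_zero _
    | add x y _ _ hx hy => rw [map_add, hx, hy, add_zero]
    | smul a x _ hx => rw [map_smul, hx, smul_zero]
  · intro hv
    obtain ⟨c, hc⟩ := (Submodule.mem_span_range_iff_exists_fun _).1
      ((hypergeom_exact hM hn hab).2.2 v ((mem_sections M).1 v.2) hv)
    refine (Submodule.mem_span_range_iff_exists_fun _).2 ⟨c, Subtype.ext ?_⟩
    rw [← hc, AddSubmonoidClass.coe_finsetSum]
    rfl

theorem exists_shapovalov_eq (hM : diag n K ≤ M) (hn : ¬ p ∣ n) {a b : ℕ}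
    (hab : a + 1 + (b + 1) = p) (hb : b + 1 < p) (g : Fin (n * (b + 1) / p) → Fun M) :
    ∃ v, ∀ l : Fin (n * (b + 1) / p), shapovalov M (hypergeomSection M hb l) v = g l := by
  obtain ⟨v, hs, hv⟩ := (hypergeom_exact hM hn hab).2.1 0 g
  exact ⟨⟨v, (mem_sections M).2 hs⟩, hv⟩

end Assembly

end KZModP

end

open KZModP in
theorem theorem1p6 {n p : ℕ} [Fact p.Prime] (hn : ¬ p ∣ n) {K : Type*} [Field K] [CharP K p]
    (h : ZMod p) (hh : h ≠ 0) :
    ∃ (U : Submodule (Fun (diag n K)) (sections (diag n K)))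
      (hU : (KZ (diag n K) (h.cast : K)).Preserves U)
      (b : Module.Basis (Fin (n * h.val / p)) (Fun (diag n K)) U)
      (y : Fin (n * (-h).val / p) → sections (diag n K))
      (c : Module.Basis (Fin (n * (-h).val / p)) (Fun (diag n K))
        (Module.Dual (Fun (diag n K)) (sections (diag n K) ⧸ U))),
      -- the `p`-hypergeometric solutions of `KZ(h)` form a flat basis of `U`
      (∀ k, ((b k : sections (diag n K)) : Fin n → Fun (diag n K)) =
        hypergeom (diag n K) p h.val k) ∧
      (∀ k, ((KZ (diag n K) (h.cast : K)).restrict U hU).IsFlatSection (b k)) ∧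
      -- the quotient is a trivial flat bundle
      ((KZ (diag n K) (h.cast : K)).quotient U hU).IsTrivialFlat (n - 1 - n * h.val / p) ∧
      -- the `p`-hypergeometric solutions `y` of `KZ(-h)` are flat for `KZ(-h)`, define flat
      -- functionals by the Shapovalov form, and annihilate `U`
      (∀ k, (y k : Fin n → Fun (diag n K)) = hypergeom (diag n K) p (-h).val k) ∧
      (∀ k, (KZ (diag n K) (-(h.cast : K))).IsFlatSection (y k)) ∧
      (∀ k, (KZ (diag n K) (h.cast : K)).dual.IsFlatSection (shapovalov (diag n K) (y k))) ∧
      (∀ k, ∀ u ∈ U, shapovalov (diag n K) (y k) u = 0) ∧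
      -- they induce a flat basis of the dual of the quotient
      (∀ k, ∀ v, c k (U.mkQ v) = shapovalov (diag n K) (y k) v) ∧
      (∀ k, ((KZ (diag n K) (h.cast : K)).quotient U hU).dual.IsFlatSection (c k)) ∧
      -- the Shapovalov form induces an isomorphism from the span of the `p`-hypergeometric
      -- solutions of `KZ(-h)` to the dual of the quotient
      (∃ e : Submodule.span (Fun (diag n K)) (Set.range y) ≃ₗ[Fun (diag n K)]
          Module.Dual (Fun (diag n K)) (sections (diag n K) ⧸ U),
        ∀ w v, e w (U.mkQ v) = shapovalov (diag n K) w v) ∧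
      -- if `U ≠ 0`, every flat section, over each principal open subset `f ≠ 0` of `S`
      -- (hence over every open subset) as well as over `S`,
      -- belongs to `U`, and the global ones form a free module with the basis `b`
      (U ≠ ⊥ →
        (∀ (f : MvPolynomial (Fin n) K)
          (v : sections (diag n K ⊔ Submonoid.powers f)),
          (KZ (diag n K ⊔ Submonoid.powers f) (h.cast : K)).IsFlatSection v →
          (v : Fin n → Fun (diag n K ⊔ Submonoid.powers f)) ∈
            Submodule.span (Fun (diag n K ⊔ Submonoid.powers f))
              (Set.range fun k : Fin (n * h.val / p) =>
                hypergeom (diag n K ⊔ Submonoid.powers f) p h.val k)) ∧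
        (∀ v, (KZ (diag n K) (h.cast : K)).IsFlatSection v → v ∈ U) ∧
        ∃ e : Module.Basis (Fin (n * h.val / p)) (powRing (diag n K) p)
            ((KZ (diag n K) (h.cast : K)).flatSections (powRing (diag n K) p)
              (partialD_powRing (diag n K) p)),
          ∀ k, (e k : sections (diag n K)) = b k) ∧
      -- if `U = 0`, the global flat sections form a free module of rank `n - 1`
      (U = ⊥ →
        Nonempty (Module.Basis (Fin (n - 1)) (powRing (diag n K) p)
          ((KZ (diag n K) (h.cast : K)).flatSections (powRing (diag n K) p)
            (partialD_powRing (diag n K) p)))) := by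
  have hpos : 0 < h.val := Nat.pos_of_ne_zero fun h0 => hh ((ZMod.val_eq_zero h).1 h0)
  have hlt : h.val < p := ZMod.val_lt h
  have hneg : h.val + (-h).val = p := by
    have : NeZero h := ⟨hh⟩
    rw [ZMod.val_neg_of_ne_zero]
    omega
  have hcast : (h.cast : K) = ((h.val : ℕ) : K) := (ZMod.natCast_val h).symm
  rw [hcast]
  generalize h.val = m at *
  generalize (-h).val = m' at *
  obtain ⟨a, rfl⟩ : ∃ a, m = a + 1 := ⟨m - 1, by omega⟩
  obtain ⟨b, rfl⟩ : ∃ b, m' = b + 1 := ⟨m' - 1, by omega⟩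
  have hab := hneg
  have hba : b + 1 + (a + 1) = p := by omega
  have ha : a + 1 < p := hlt
  have hb : b + 1 < p := by omega
  have hcK : -((a + 1 : ℕ) : K) = ((b + 1 : ℕ) : K) := by
    rw [neg_eq_iff_add_eq_zero, ← Nat.cast_add, hab, CharP.cast_eq_zero]
  have hdom : IsDomain (Fun (diag n K)) :=
    IsLocalization.isDomain_of_le_nonZeroDivisors (Fun (diag n K)) (diag_le_nonZeroDivisors (n := n) (K := K))
  set D := KZ (diag n K) ((a + 1 : ℕ) : K) with hD
  set bv : Fin (n * (a + 1) / p) → sections (diag n K) :=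
    fun k => hypergeomSection (diag n K) ha k with hbv
  set y : Fin (n * (b + 1) / p) → sections (diag n K) :=
    fun k => hypergeomSection (diag n K) hb k with hy
  have hbflat : ∀ k, D.IsFlatSection (bv k) := fun k => hypergeomSection_isFlatSection le_rfl ha k
  have hyflat : ∀ k, (KZ (diag n K) (-((a + 1 : ℕ) : K))).IsFlatSection (y k) := fun k => by
    rw [hcK]
    exact hypergeomSection_isFlatSection le_rfl hb k
  have hyd : ∀ k, D.dual.IsFlatSection (shapovalov (diag n K) (y k)) :=
    fun k => shapovalov_isFlatSection (hyflat k)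
  have hbli : LinearIndependent (Fun (diag n K)) bv :=
    hypergeomSection_linearIndependent le_rfl hn hab ha
  have hyli : LinearIndependent (Fun (diag n K)) y :=
    hypergeomSection_linearIndependent le_rfl hn hba hb
  set U := Submodule.span (Fun (diag n K)) (Set.range bv) with hUdef
  have hU : D.Preserves U := D.preserves_span hbflat
  have hker : ∀ v, v ∈ U ↔ ∀ l, shapovalov (diag n K) (y l) v = 0 :=
    mem_span_hypergeomSection_iff le_rfl hn hab ha hb
  obtain ⟨β, hβ⟩ := exists_basis_quotient U (fun l => shapovalov (diag n K) (y l))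
    (exists_shapovalov_eq (M := diag n K) le_rfl hn hab hb) hker
  have hβdual : ∀ l, (D.quotient U hU).dual.IsFlatSection (β.coord l) :=
    fun l => D.isFlatSection_dual_quotient hU (hyd l) (hβ l)
  have hβflat : ∀ l, (D.quotient U hU).IsFlatSection (β l) :=
    (D.quotient U hU).isFlatSection_of_coord β hβdual
  have hrank : n * (b + 1) / p = n - 1 - n * (a + 1) / p := by
    have h1 := div_add_div_add_one hab hn
    generalize n * (b + 1) / p = e at h1 ⊢
    generalize n * (a + 1) / p = d at h1 ⊢
    omega
  have hcoord : ∀ l, β.dualBasis l = β.coord l := fun l => by rw [Module.Basis.coe_dualBasis]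
  have hbU : ∀ k, ((Module.Basis.span hbli k : U) : sections (diag n K)) = bv k :=
    fun k => by rw [Module.Basis.span_apply]
  refine ⟨U, hU, Module.Basis.span hbli, y, β.dualBasis, fun k => ?_, fun k i => ?_, ?_, fun k => rfl,
    hyflat, hyd, fun k u hu => (hker u).1 hu k, fun k v => ?_, fun k => ?_, ?_, fun hne => ?_,
    fun hbot => ?_⟩
  · rw [hbU]
    rfl
  · refine Subtype.ext ?_
    change D.nabla i _ = 0
    rw [hbU]
    exact hbflat k i
  · refine ⟨β.reindex (finCongr hrank), fun k => ?_⟩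
    rw [Module.Basis.reindex_apply]
    exact hβflat _
  · rw [hcoord]
    exact hβ k v
  · rw [hcoord]
    exact hβdual k
  · refine ⟨(Module.Basis.span hyli).equiv β.dualBasis (Equiv.refl _), fun w v => ?_⟩
    have heq : U.mkQ.dualMap ∘ₗ
          ((Module.Basis.span hyli).equiv β.dualBasis (Equiv.refl _)).toLinearMap =
        shapovalov (diag n K) ∘ₗ (Submodule.span (Fun (diag n K)) (Set.range y)).subtype := by
      refine (Module.Basis.span hyli).ext fun l => LinearMap.ext fun v => ?_
      change ((Module.Basis.span hyli).equiv β.dualBasis (Equiv.refl _)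
        (Module.Basis.span hyli l)) (U.mkQ v) =
          shapovalov (diag n K) (Module.Basis.span hyli l : sections (diag n K)) v
      rw [Module.Basis.equiv_apply, Equiv.refl_apply, hcoord, hβ, Module.Basis.span_apply]
    exact LinearMap.congr_fun (LinearMap.congr_fun heq w) v
  -- 𝒰 ≠ 0 means that there is at least one solution; this is the degree bound needed for the
  -- nonvanishing derivative.
  · have hpn : p ≤ n * (a + 1) := by
      by_contra hcon
      refine hne ?_
      have h0 : n * (a + 1) / p = 0 := Nat.div_eq_of_lt (by omega)
      rw [hUdef, Submodule.span_eq_bot]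
      rintro _ ⟨k, rfl⟩
      exact absurd k.2 (by omega)
    have hflat : ∀ M : Submonoid (MvPolynomial (Fin n) K), diag n K ≤ M →
        M ≤ nonZeroDivisors (MvPolynomial (Fin n) K) → ∀ v : sections M,
        (KZ M ((a + 1 : ℕ) : K)).IsFlatSection v →
        ∀ l : Fin (n * (b + 1) / p), ∑ j, v.1 j * hypergeom M p (b + 1) l j = 0 := by
      intro M hM hM' v hv
      refine sum_mul_hypergeom_eq_zero hM hM' hba hpn hn ?_
      rw [← hcK, neg_neg]
      exact (KZ_isFlatSection_iff _ _).1 hv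
    have hglob : ∀ v, D.IsFlatSection v → v ∈ U := fun v hv =>
      (hker v).2 (hflat _ le_rfl diag_le_nonZeroDivisors v hv)
    refine ⟨fun f v hv => ?_, hglob, ?_⟩
    -- For f = 0 the open subset is empty and its ring of functions is zero.
    · by_cases hf : f = 0
      · have h0 : (0 : MvPolynomial (Fin n) K) ∈ diag n K ⊔ Submonoid.powers f :=
          (le_sup_right : Submonoid.powers f ≤ _) (hf ▸ Submonoid.mem_powers f)
        have : Subsingleton (Fun (diag n K ⊔ Submonoid.powers f)) :=
          IsLocalization.subsingleton h0
        rw [Subsingleton.elim (v : Fin n → Fun (diag n K ⊔ Submonoid.powers f)) 0]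
        exact Submodule.zero_mem _
      · refine (hypergeom_exact le_sup_left hn hab).2.2 _ ((mem_sections _).1 v.2)
          (hflat _ le_sup_left (sup_le diag_le_nonZeroDivisors ?_) v hv)
        exact Submonoid.powers_le.2 (mem_nonZeroDivisors_of_ne_zero hf)
    · obtain ⟨e, he⟩ := D.exists_basis_flatSections (powRing (diag n K) p)
        (partialD_powRing (diag n K) p) (fun _ => mem_powRing_of_partialD_eq_zero) hbli hbflat hglob
      exact ⟨e, fun k => by rw [he, hbU]⟩
  · have h0 : n * (a + 1) / p = 0 := by
      by_contra h0
      let k : Fin (n * (a + 1) / p) := ⟨0, Nat.pos_of_ne_zero h0⟩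
      have hk : bv k ∈ U := Submodule.subset_span ⟨k, rfl⟩
      rw [hbot, Submodule.mem_bot] at hk
      exact hbli.ne_zero k hk
    have hn1 : n * (b + 1) / p = n - 1 := by rw [hrank, h0, Nat.sub_zero]
    -- When 𝒰 = 0 the quotient is the whole bundle, so the flat basis of the quotient is a flat
    -- basis of sections.
    set γ := (β.map (Submodule.quotEquivOfEqBot U hbot)).reindex (finCongr hn1) with hγ
    have hγflat : ∀ k, D.IsFlatSection (γ k) := by
      intro k i
      have h1 : U.mkQ (γ k) = β ((finCongr hn1).symm k) := by
        rw [hγ, Module.Basis.reindex_apply, Module.Basis.map_apply]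
        exact (Submodule.quotEquivOfEqBot U hbot).symm_apply_apply _
      have h2 := hβflat ((finCongr hn1).symm k) i
      rw [← h1, D.quotient_mkQ] at h2
      have h3 : D.nabla i (γ k) ∈ U := (Submodule.Quotient.mk_eq_zero U).1 h2
      rwa [hbot, Submodule.mem_bot] at h3
    obtain ⟨e, -⟩ := D.exists_basis_flatSections (powRing (diag n K) p)
      (partialD_powRing (diag n K) p) (fun _ => mem_powRing_of_partialD_eq_zero)
      γ.linearIndependent hγflat fun v _ => by rw [γ.span_eq]; trivial
    exact ⟨e⟩
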